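/- Let $\tilde\nu$ be a positive regular Borel measure on $[0,\infty)$, finite on bounded sets, with $\tilde\nu[0,r)>0$ for all $r>0$ and $$\sup_{r>0}\frac{\tilde\nu[0,2r)}{\tilde\nu[0,r)}<\infty ,$$ let $\nu=\tilde\nu\otimes\lambda$ ($\lambda$ Lebesgue measure) be the corresponding measure on $\overline{\mathbb C_+}=[0,\infty)\times\mathbb R$, where $\mathbb C_+=\{z:\operatorname{Re}z>0\}$ (so that $A^2_\nu$ is a Zen space), and let $$w(t)=2\pi\int_{[0,\infty)}e^{-2rt}\,d\tilde\nu(r),\qquad t>0 .$$ Then there is $N_0\ge 1$, depending only on $\tilde\nu$, such that for every $N\ge N_0$ the following holds. Let $A:D(A)\subset H\to H$ be the infinitesimal generator of a $C_0$-semigroup $(T(t))_{t\ge0}$ on a complex Hilbert space $H$, and suppose that $A$ has a (countable) Riesz basis $(\phi_k)$ of eigenvectors, that is, $A\phi_k=\lambda_k\phi_k$, $(\phi_k)$ is a Schauder basis of $H$, and $C_1\sum|a_k|^2\le\|\sum a_k\phi_k\|^2\le C_2\sum|a_k|^2$ for all $(a_k)\in\ell^2$, with constants $C_1,C_2>0$.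 Suppose that $\operatorname{Re}\lambda_k<0$ for all $k$. Let $D(A^*)'$ be the completion of $H$ with respect to the norm $\|(\beta-A)^{-1}x\|_H$, where $\beta\in\rho(A)$, and extend $T(t)$ and, for $\lambda\in\mathbb C_+$ and $N\ge1$, $(\lambda-A)^{-N}$ continuously to maps $D(A^*)'\to D(A^*)'$ and $D(A^*)'\to H$. Let $B:\mathbb C\to D(A^*)'$ be a bounded linear map given by the sequence $(b_k)$, that is, $B1=\sum_k b_k\phi_k$ in $D(A^*)'$. Then the following are equivalent. 1. $B$ is an admissible control operator with respect to $L^2_w(0,\infty)=L^2((0,\infty),w(t)\,dt)$: there is a constant $m_0>0$ such that for every $u\in L^2_w(0,\infty)$ the improper integral $\int_0^\infty T(t)Bu(t)\,dt=\lim_{\tau\to\infty}\int_0^\tau T(t)Bu(t)\,dt$ (Bochner integrals and limit in $D(A^*)'$) exists, belongs to $H$, and satisfies $$\Big\|\int_0^\infty T(t)Bu(t)\,dt\Big\|_H\le m_0\|u\|_{L^2_w(0,\infty)} .$$ 2. There is a constant $\kappa>0$ such that $$\|(\lambda-A)^{-N}B\|^2\le\kappa\int_0^\infty|t^{N-1}e^{-\lambda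 t}|^2w(t)\,dt\qquad(\lambda\in\mathbb C_+).$$ 3. There is a constant $\kappa>0$ such that the measure $\mu=\sum_k|b_k|^2\delta_{-\lambda_k}$ satisfies $\mu(Q_I)\le\kappa\,\nu(Q_I)$ for every bounded interval $I\subset i\mathbb R$, where $Q_I=\{x+iy: iy\in I,\ 0\le x<|I|\}$ is the Carleson square over $I$. -/

import Mathlib

open MeasureTheory Filter Topology
open scoped ENNReal NNReal

noncomputable section

namespace ZenAdm

/-! ### Strongly continuous semigroups, generators and resolvents -/

section Operators

variable {H : Type*} [NormedAddCommGroup H] [InnerProductSpace ℂ H]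

/-- `(T(t))_{t ≥ 0}` is a `C₀`-semigroup of bounded operators; the values at negative times are
irrelevant. -/
structure IsC0Semigroup (T : ℝ → H →L[ℂ] H) : Prop where
  map_zero : T 0 = ContinuousLinearMap.id ℂ H
  map_add : ∀ s t : ℝ, 0 ≤ s → 0 ≤ t → T (s + t) = (T s).comp (T t)
  tendsto_zero : ∀ x : H, Tendsto (fun t => T t x) (𝓝[>] 0) (𝓝 x)

/-- `A` is the infinitesimal generator of `T`: `x ∈ D(A)` and `A x = y` if and only if
`(T(t) x - x) / t → y` as `t ↓ 0`. -/
def IsGenerator (A : H →ₗ.[ℂ] H) (T : ℝ → H →L[ℂ] H) : Prop :=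
  ∀ x y : H, (x, y) ∈ A.graph ↔
    Tendsto (fun t : ℝ => (t : ℂ)⁻¹ • (T t x - x)) (𝓝[>] 0) (𝓝 y)

/-- `R` is a bounded two-sided inverse of `l - A : D(A) → H`. -/
def IsResolventAt (A : H →ₗ.[ℂ] H) (l : ℂ) (R : H →L[ℂ] H) : Prop :=
  (∀ x : A.domain, R (l • (x : H) - A x) = x) ∧
    ∀ y : H, ∃ h : R y ∈ A.domain, l • R y - A ⟨R y, h⟩ = y

/-- The resolvent set `ρ(A)` of an unbounded operator. -/
def resolventSet (A : H →ₗ.[ℂ] H) : Set ℂ := {l | ∃ R, IsResolventAt A l R}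

open Classical in
/-- The resolvent `(l - A)⁻¹`, for `l ∈ ρ(A)` (and `0` otherwise). -/
def resolvent (A : H →ₗ.[ℂ] H) (l : ℂ) : H →L[ℂ] H :=
  if h : l ∈ resolventSet A then h.choose else 0

theorem isResolventAt_resolvent {A : H →ₗ.[ℂ] H} {l : ℂ} (h : l ∈ resolventSet A) :
    IsResolventAt A l (resolvent A l) := by
  rw [resolvent, dif_pos h]
  exact h.choose_spec

/-- `φ_k ∈ D(A)` and `A φ_k = l_k φ_k` for every `k`. -/
def IsEigenfamily {ι : Type*} (A : H →ₗ.[ℂ] H) (φ : ι → H) (l : ι → ℂ) : Prop :=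
  ∀ k, (φ k, l k • φ k) ∈ A.graph

/-- A Riesz basis: an (unconditional) Schauder basis with
`C₁ ∑ |a_k|² ≤ ‖∑ a_k φ_k‖² ≤ C₂ ∑ |a_k|²` for all square-summable `(a_k)`. -/
def IsRieszBasis {ι : Type*} (φ : ι → H) : Prop :=
  (∃ e : UnconditionalSchauderBasis ι ℂ H, ∀ k, e k = φ k) ∧
    ∃ C₁ C₂ : ℝ, 0 < C₁ ∧ 0 < C₂ ∧ ∀ a : ι → ℂ, Summable (fun k => ‖a k‖ ^ 2) →
      ∃ x : H, HasSum (fun k => a k • φ k) x ∧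
        C₁ * ∑' k, ‖a k‖ ^ 2 ≤ ‖x‖ ^ 2 ∧ ‖x‖ ^ 2 ≤ C₂ * ∑' k, ‖a k‖ ^ 2

/-! ### The extrapolation space `D(A*)'` -/

/-- The vector space `H`, to be equipped with the norm `‖x‖ = ‖(β - A)⁻¹ x‖_H`. -/
def PreExtrapolation (_A : H →ₗ.[ℂ] H) (_β : ℂ) : Type _ := H

instance (A : H →ₗ.[ℂ] H) (β : ℂ) : AddCommGroup (PreExtrapolation A β) :=
  inferInstanceAs (AddCommGroup H)

instance (A : H →ₗ.[ℂ] H) (β : ℂ) : Module ℂ (PreExtrapolation A β) :=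
  inferInstanceAs (Module ℂ H)

/-- The identity map from `H` to `H` with the new norm. -/
def toPre (A : H →ₗ.[ℂ] H) (β : ℂ) : H ≃ₗ[ℂ] PreExtrapolation A β := LinearEquiv.refl ℂ H

/-- `x ↦ (β - A)⁻¹ x` on the space with the new norm. -/
def preResolvent (A : H →ₗ.[ℂ] H) (β : ℂ) : PreExtrapolation A β →ₗ[ℂ] H :=
  (resolvent A β : H →ₗ[ℂ] H) ∘ₗ ((toPre A β).symm : PreExtrapolation A β →ₗ[ℂ] H)

instance (A : H →ₗ.[ℂ] H) (β : ℂ) : SeminormedAddCommGroup (PreExtrapolation A β) :=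
  SeminormedAddCommGroup.induced _ _ (preResolvent A β)

instance (A : H →ₗ.[ℂ] H) (β : ℂ) : NormedSpace ℂ (PreExtrapolation A β) :=
  NormedSpace.induced ℂ _ _ (preResolvent A β)

theorem norm_toPre (A : H →ₗ.[ℂ] H) (β : ℂ) (x : H) : ‖toPre A β x‖ = ‖resolvent A β x‖ := rfl

/-- The space `D(A*)'`: the completion of `H` with respect to the norm `‖(β - A)⁻¹ x‖_H`,
where `β ∈ ρ(A)`. -/
abbrev Extrapolation (A : H →ₗ.[ℂ] H) (β : ℂ) : Type _ :=
  UniformSpace.Completion (PreExtrapolation A β)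

/-- The embedding of `H` into `D(A*)'`. -/
def embed (A : H →ₗ.[ℂ] H) (β : ℂ) (x : H) : Extrapolation A β :=
  (toPre A β x : UniformSpace.Completion (PreExtrapolation A β))

/-- The continuous extension to `D(A*)'` of a bounded operator on `H` (which has one as soon as
the operator commutes with `(β - A)⁻¹`); it is used for the semigroup operators. -/
def extend (A : H →ₗ.[ℂ] H) (β : ℂ) (S : H →L[ℂ] H) : Extrapolation A β → Extrapolation A β :=
  UniformSpace.Completion.map fun y => toPre A β (S ((toPre A β).symm y))

/-- The continuous extension to an `H`-valued map on `D(A*)'` of a bounded operator on `H` (which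
has one as soon as the operator factors through `(β - A)⁻¹`); it is used for the powers
`(l - A)^{-N}` with `N ≥ 1`. -/
def extendToH [CompleteSpace H] (A : H →ₗ.[ℂ] H) (β : ℂ) (S : H →L[ℂ] H) : Extrapolation A β → H :=
  UniformSpace.Completion.extension fun y => S ((toPre A β).symm y)

theorem uniformContinuous_of_commute (A : H →ₗ.[ℂ] H) (β : ℂ) (S : H →L[ℂ] H)
    (hS : ∀ x, resolvent A β (S x) = S (resolvent A β x)) :
    UniformContinuous fun y => toPre A β (S ((toPre A β).symm y)) := by
  let F : PreExtrapolation A β →ₗ[ℂ] PreExtrapolation A β :=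
    (toPre A β : H →ₗ[ℂ] _) ∘ₗ (S : H →ₗ[ℂ] H) ∘ₗ ((toPre A β).symm : _ →ₗ[ℂ] H)
  refine (F.mkContinuous ‖S‖ fun y => ?_).uniformContinuous
  obtain ⟨x, rfl⟩ := (toPre A β).surjective y
  exact ((congrArg norm (hS x)).trans_le (S.le_opNorm _) :
    ‖resolvent A β (S x)‖ ≤ ‖S‖ * ‖resolvent A β x‖)

theorem extend_embed (A : H →ₗ.[ℂ] H) (β : ℂ) (S : H →L[ℂ] H)
    (hS : ∀ x, resolvent A β (S x) = S (resolvent A β x)) (x : H) :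
    extend A β S (embed A β x) = embed A β (S x) :=
  UniformSpace.Completion.map_coe (uniformContinuous_of_commute A β S hS) _

/-- The semigroup operators commute with the resolvent of the generator. -/
theorem resolvent_comm {A : H →ₗ.[ℂ] H} {T : ℝ → H →L[ℂ] H} (hT : IsC0Semigroup T)
    (hA : IsGenerator A T) {β : ℂ} (hβ : β ∈ resolventSet A) {t : ℝ} (ht : 0 ≤ t) (x : H) :
    resolvent A β (T t x) = T t (resolvent A β x) := by
  obtain ⟨h1, h2⟩ := isResolventAt_resolvent hβ
  obtain ⟨hy, hx⟩ := h2 x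
  generalize resolvent A β x = y at hy hx ⊢
  have hg : (y, A ⟨y, hy⟩) ∈ A.graph := A.mem_graph ⟨y, hy⟩
  have hlim := (hA _ _).1 hg
  have hg' : (T t y, T t (A ⟨y, hy⟩)) ∈ A.graph := by
    rw [hA]
    refine (((T t).continuous.tendsto _).comp hlim).congr' ?_
    filter_upwards [self_mem_nhdsWithin] with s hs
    have hs : 0 < s := hs
    have hc : T s (T t y) = T t (T s y) := by
      have e1 := hT.map_add s t hs.le ht
      have e2 := hT.map_add t s ht hs.le
      rw [add_comm, e1] at e2
      exact congrArg (fun L : H →L[ℂ] H => L y) e2.symm |>.symm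
    simp [hc]
  obtain ⟨z, hz1, hz2⟩ := A.mem_graph_iff.1 hg'
  have := h1 z
  rw [hz1, hz2] at this
  simp only at this
  rw [← this, ← hx]
  simp

/-- For `l, β ∈ ρ(A)` and `N ≥ 1` the operator `(l - A)^{-N}` is uniformly continuous for the
norm of `D(A*)'`, so that its extension is a genuine one. -/
theorem uniformContinuous_resolvent_pow {A : H →ₗ.[ℂ] H} {β l : ℂ} (hβ : β ∈ resolventSet A)
    (hl : l ∈ resolventSet A) (n : ℕ) :
    UniformContinuous fun y => (resolvent A l ^ (n + 1)) ((toPre A β).symm y) := by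
  obtain ⟨h1, -⟩ := isResolventAt_resolvent hl
  obtain ⟨-, h2⟩ := isResolventAt_resolvent hβ
  let G : H →L[ℂ] H := ContinuousLinearMap.id ℂ H + (β - l) • resolvent A l
  have key : ∀ x, resolvent A l x = G (resolvent A β x) := by
    intro x
    obtain ⟨hy, hx⟩ := h2 x
    have e := h1 ⟨_, hy⟩
    simp only at e
    have : x = (l • resolvent A β x - A ⟨_, hy⟩) + (β - l) • resolvent A β x := by
      nth_rewrite 1 [← hx]
      rw [sub_smul]
      abel
    have e' := congrArg (resolvent A l) this
    rw [map_add, e, map_smul] at e'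
    simpa [G] using e'
  let F : PreExtrapolation A β →ₗ[ℂ] H :=
    ((resolvent A l ^ (n + 1) : H →L[ℂ] H) : H →ₗ[ℂ] H) ∘ₗ ((toPre A β).symm : _ →ₗ[ℂ] H)
  refine (F.mkContinuous ‖(resolvent A l ^ n).comp G‖ fun y => ?_).uniformContinuous
  obtain ⟨x, rfl⟩ := (toPre A β).surjective y
  have : (resolvent A l ^ (n + 1)) x = ((resolvent A l ^ n).comp G) (resolvent A β x) := by
    rw [pow_succ, ContinuousLinearMap.comp_apply, ← key]
    rfl
  exact ((congrArg norm this).trans_le (ContinuousLinearMap.le_opNorm _ _) :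
    ‖(resolvent A l ^ (n + 1)) x‖ ≤ _ * ‖resolvent A β x‖)

end Operators

/-! ### Zen measures, weights and Carleson squares -/

/-- The condition on a locally finite Borel measure on `[0, ∞)` under which it defines Zen
spaces: `sup_{r > 0} ν̃[0, 2r) / ν̃[0, r) < ∞`, the denominators being nonzero. -/
structure IsZenMeasure (ν : Measure ℝ≥0) : Prop where
  locallyFinite : IsLocallyFiniteMeasure ν
  pos : ∀ r : ℝ≥0, 0 < r → 0 < ν (Set.Iio r)
  doubling : ∃ R : ℝ≥0, ∀ r : ℝ≥0, 0 < r → ν (Set.Iio (2 * r)) ≤ R * ν (Set.Iio r)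

/-- The measure `ν = ν̃ ⊗ λ` on the closed right half-plane, as a measure on `ℂ`. -/
def planeMeasure (ν : Measure ℝ≥0) : Measure ℂ :=
  (ν.prod (volume : Measure ℝ)).map fun p => ((p.1 : ℝ) : ℂ) + (p.2 : ℂ) * Complex.I

/-- The weight `w(t) = 2π ∫ e^{-2rt} dν̃(r)`. -/
def weight (ν : Measure ℝ≥0) (t : ℝ) : ℝ≥0∞ :=
  ENNReal.ofReal (2 * Real.pi) * ∫⁻ r : ℝ≥0, ENNReal.ofReal (Real.exp (-2 * (r : ℝ) * t)) ∂ν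

/-- The measure `w(t) dt` on `(0, ∞)`. -/
def weightMeasure (ν : Measure ℝ≥0) : Measure ℝ :=
  (volume.restrict (Set.Ioi (0 : ℝ))).withDensity (weight ν)

/-- The Carleson square over the interval `i I` of the imaginary axis. Its left edge belongs to
it: for instance for the Hardy space the whole of `ν` lies on the imaginary axis. -/
def carlesonSquare (I : Set ℝ) : Set ℂ :=
  {z | 0 ≤ z.re ∧ z.re < volume.real I ∧ z.im ∈ I}

/-- The measure `∑ |b_k|² δ_{-l_k}`. -/
def spectralMeasure {ι : Type*} (b l : ι → ℂ) : Measure ℂ :=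
  Measure.sum fun k => ENNReal.ofReal (‖b k‖ ^ 2) • Measure.dirac (-l k)

/-! ### The three conditions -/

/-- `y = ∫_0^∞ f(t) dt` as an improper integral: `f` is Bochner integrable on every `(0, τ]` and
the integrals converge to `y` as `τ → ∞`. -/
def HasImproperIntegral {E : Type*} [NormedAddCommGroup E] [NormedSpace ℝ E]
    (f : ℝ → E) (y : E) : Prop :=
  (∀ τ : ℝ, IntegrableOn f (Set.Ioc 0 τ)) ∧
    Tendsto (fun τ : ℝ => ∫ t in Set.Ioc 0 τ, f t) atTop (𝓝 y)

section Conditions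

variable {H : Type*} [NormedAddCommGroup H] [InnerProductSpace ℂ H]

/-- `B` is an admissible control operator with respect to `L²_w(0, ∞)`: for every
`u ∈ L²_w(0, ∞)` the integral `∫_0^∞ T(t) B u(t) dt` (taken in `D(A*)'`) is an element of `H`, of
norm at most `m₀ ‖u‖`. -/
def IsAdmissible (A : H →ₗ.[ℂ] H) (T : ℝ → H →L[ℂ] H) (β : ℂ) (B : ℂ →L[ℂ] Extrapolation A β)
    (ν : Measure ℝ≥0) : Prop :=
  ∃ m₀ : ℝ, 0 < m₀ ∧ ∀ u : ℝ → ℂ, MemLp u 2 (weightMeasure ν) →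
    ∃ x : H, HasImproperIntegral (fun t => extend A β (T t) (B (u t))) (embed A β x) ∧
      ‖x‖ ≤ m₀ * (eLpNorm u 2 (weightMeasure ν)).toReal

/-- `‖(l - A)^{-N} B‖² ≤ κ ∫_0^∞ |t^{N-1} e^{-lt}|² w(t) dt` for all `l` with `Re l > 0`; the
norm of an operator from `ℂ` to `H` is that of its value at `1`. -/
def ResolventBound [CompleteSpace H] (A : H →ₗ.[ℂ] H) (β : ℂ) (B : ℂ →L[ℂ] Extrapolation A β)
    (ν : Measure ℝ≥0) (N : ℕ) : Prop :=
  ∃ κ : ℝ≥0, 0 < κ ∧ ∀ l : ℂ, 0 < l.re →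
    ‖extendToH A β (resolvent A l ^ N) (B 1)‖ₑ ^ 2 ≤
      κ * ∫⁻ t in Set.Ioi (0 : ℝ),
        ‖(t : ℂ) ^ (N - 1) * Complex.exp (-l * (t : ℂ))‖ₑ ^ 2 * weight ν t

/-- `μ(Q_I) ≤ κ ν(Q_I)` for all Carleson squares. -/
def CarlesonCondition (μ : Measure ℂ) (ν : Measure ℝ≥0) : Prop :=
  ∃ κ : ℝ≥0, 0 < κ ∧ ∀ I : Set ℝ, I.OrdConnected → Bornology.IsBounded I →
    μ (carlesonSquare I) ≤ κ * planeMeasure ν (carlesonSquare I)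

end Conditions

end ZenAdm

end

noncomputable section

namespace ZenAdm

/-! ### Fourier and Laplace transforms -/

section Fourier

open scoped FourierTransform ContDiff

/-! In the coordinates of the Riesz basis everything is diagonal: `T t` multiplies the `k`-th
coordinate by `e^{l k t}` and the resolvent at `z` by `(z - l k)⁻¹`. The state produced by `u`
therefore has coordinates `b k · (ℒu)(-l k)`, where `ℒ` is the Laplace transform, and the squared
norm of the state is comparable to `∫ |ℒu|² dμ` with `μ = ∑ |b k|² δ_{-l k}`. By Plancherel on each
vertical line, integrated against `ν`, the squared `L²_w` norm of `u` is the integral of `|ℒu|²`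
over the half-plane. Admissibility thus says that `ℒu` embeds boundedly into `L²(μ)`, and the
theorem is a Carleson embedding theorem together with its test on reproducing kernels.

1 → 2: the input `t^{N-1} e^{-zt}` produces the state `(N-1)! (z - A)^{-N} B`. This works for every
`N ≥ 1`.

2 → 3: choose `z` at distance `|I|` from the imaginary axis, opposite a point of `I`. Then `|z - l
k| ≤ 3|I|` whenever `-l k` lies in `Q_I`, so the lower Riesz bound controls `μ(Q_I)` by the kernel
norm. That norm is an integral of `(|I| + r)^{-(2N-1)}` against the measure, which doubling compares
with its value on `[0, |I|)`, provided `2^{2N-1}` is at least twice the doubling constant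
(`lintegral_inv_pow_le`). Only here does `N` have to be large.

3 → 1: the embedding is `sum_mul_enorm_sq_laplace_le`. A large value of `ℒu` at a point `x + iy`
forces, through the Poisson integral, large averages of `|ℒu|` on every line `Re z = r` with `r <
x/2`. Vitali coverings turn this into a weak-type estimate with a truncated right-hand side
(`sum_filter_lt_laplace_le`), and integration over levels yields the `L²` bound. Applied to tails of
`u`, the bound makes the states at time `τ` Cauchy in `H`. -/

/-- The Fourier transform of an integrable, square-integrable function has the same `L²` norm. -/
theorem lintegral_enorm_sq_fourier_eq {f : ℝ → ℂ} (h1 : Integrable f) (h2 : MemLp f 2) :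
    ∫⁻ ξ, ‖𝓕 f ξ‖ₑ ^ 2 = ∫⁻ t, ‖f t‖ₑ ^ 2 := by
  set g : Lp ℂ 2 (volume : Measure ℝ) := h2.toLp f with hg
  set h : Lp ℂ 2 (volume : Measure ℝ) := 𝓕 g with hh
  have hfc : Continuous (𝓕 f) :=
    VectorFourier.fourierIntegral_continuous Real.continuous_fourierChar
      (L := innerₗ ℝ) continuous_inner h1
  -- The `L²` transform and the integral transform define the same tempered distribution: in both,
  -- `𝓕` can be moved onto the test function. Isometry is known for the former and transfers by
  -- almost everywhere equality.
  have key : ∀ ψ : SchwartzMap ℝ ℂ, ∫ x, ψ x • h x = ∫ x, ψ x • 𝓕 f x := by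
    intro ψ
    have e := congrArg (fun S => S ψ) (Lp.fourier_toTemperedDistribution_eq g)
    simp only [TemperedDistribution.fourier_apply, Lp.toTemperedDistribution_apply] at e
    rw [hh, ← e]
    have e2 : ∫ x, (𝓕 ψ) x • g x = ∫ x, 𝓕 ψ x • f x := by
      refine integral_congr_ae ?_
      filter_upwards [h2.coeFn_toLp] with x hx
      rw [hg, hx]
    rw [e2]
    have := VectorFourier.integral_fourierIntegral_smul_eq_flip (L := innerₗ ℝ)
      (μ := volume) (ν := volume) Real.continuous_fourierChar continuous_inner
      ψ.integrable h1
    simpa using! this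
  have hae : ∀ᵐ x, h x = 𝓕 f x := by
    refine ae_eq_of_integral_contDiff_smul_eq
      ((Lp.memLp h).locallyIntegrable (by norm_num)) hfc.locallyIntegrable ?_
    intro φ hφ hc
    have hg₁ : HasCompactSupport (Complex.ofRealCLM ∘ φ) := hc.comp_left rfl
    have hg₂ : ContDiff ℝ ∞ (Complex.ofRealCLM ∘ φ) := by fun_prop
    have := key (hg₁.toSchwartzMap hg₂)
    simpa using this
  have hn : ‖h‖ₑ = ‖g‖ₑ := by
    rw [← ofReal_norm, ← ofReal_norm, hh, Lp.norm_fourier_eq]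
  rw [Lp.enorm_def, Lp.enorm_def, eLpNorm_congr_ae hae, hg, eLpNorm_congr_ae h2.coeFn_toLp] at hn
  have e := congrArg (· ^ (2 : ℝ)) hn
  simp only [eLpNorm_eq_lintegral_rpow_enorm_toReal (p := 2) (by norm_num) (by norm_num)] at e
  simp only [ENNReal.toReal_ofNat, one_div, ← ENNReal.rpow_mul] at e
  norm_num at e
  exact e


/-- The Fourier transform of `t ↦ e^{-δ|t|}` is the Cauchy density, up to scaling. -/
theorem fourier_exp_neg_abs {δ : ℝ≥0} (hδ : 0 < δ) (ξ : ℝ) :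
    𝓕 (fun t : ℝ => Complex.exp (-((δ * |t| : ℝ) : ℂ))) ξ =
      ((2 * Real.pi * ProbabilityTheory.cauchyPDFReal 0 δ (2 * Real.pi * ξ) : ℝ) : ℂ) := by
  rw [Real.fourier_real_eq_integral_exp_smul]
  have hδ' : (0 : ℝ) < δ := hδ
  set a : ℂ := (δ : ℂ) - 2 * Real.pi * ξ * Complex.I with ha
  set c : ℂ := -(δ : ℂ) - 2 * Real.pi * ξ * Complex.I with hc
  have har : 0 < a.re := by simp [ha]; exact_mod_cast hδ
  have hcr : c.re < 0 := by simp [hc]; exact_mod_cast hδ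
  have e1 : Set.EqOn (fun v : ℝ => Complex.exp (((-2 * Real.pi * v * ξ : ℝ) : ℂ) * Complex.I) •
      Complex.exp (-((δ * |v| : ℝ) : ℂ))) (fun v : ℝ => Complex.exp (a * v)) (Set.Iic 0) := by
    intro v hv
    simp only [smul_eq_mul, ← Complex.exp_add, abs_of_nonpos (Set.mem_Iic.1 hv), ha]
    congr 1
    push_cast
    ring
  have e2 : Set.EqOn (fun v : ℝ => Complex.exp (((-2 * Real.pi * v * ξ : ℝ) : ℂ) * Complex.I) •
      Complex.exp (-((δ * |v| : ℝ) : ℂ))) (fun v : ℝ => Complex.exp (c * v)) (Set.Ioi 0) := by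
    intro v hv
    simp only [smul_eq_mul, ← Complex.exp_add, abs_of_pos (Set.mem_Ioi.1 hv), hc]
    congr 1
    push_cast
    ring
  rw [← intervalIntegral.integral_Iic_add_Ioi (b := 0)
      ((integrableOn_exp_mul_complex_Iic har 0).congr_fun e1.symm measurableSet_Iic)
      ((integrableOn_exp_mul_complex_Ioi hcr 0).congr_fun e2.symm measurableSet_Ioi),
    setIntegral_congr_fun measurableSet_Iic e1, setIntegral_congr_fun measurableSet_Ioi e2,
    integral_exp_mul_complex_Iic har, integral_exp_mul_complex_Ioi hcr,
    ProbabilityTheory.cauchyPDFReal_def]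
  have ha0 : a ≠ 0 := fun h => by simp [h] at har
  have hc0 : c ≠ 0 := fun h => by simp [h] at hcr
  have hac : a * c = -((((2 * Real.pi * ξ - 0) ^ 2 + (δ : ℝ) ^ 2 : ℝ)) : ℂ) := by
    simp only [ha, hc]
    push_cast
    linear_combination (-(4 * Real.pi ^ 2 * ξ ^ 2) : ℂ) * (-1 : ℂ) * Complex.I_sq
  have hpos : (((2 * Real.pi * ξ - 0) ^ 2 + (δ : ℝ) ^ 2 : ℝ) : ℂ) ≠ 0 := by
    exact_mod_cast (by positivity : (0 : ℝ) < (2 * Real.pi * ξ - 0) ^ 2 + (δ : ℝ) ^ 2).ne'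
  have hpi : (Real.pi : ℂ) ≠ 0 := by exact_mod_cast Real.pi_ne_zero
  have e3 : (((2 * Real.pi * ξ - 0) ^ 2 + (δ : ℝ) ^ 2 : ℝ) : ℂ) = -(a * c) := by rw [hac, neg_neg]
  have hac2 : c - a = -2 * (δ : ℂ) := by simp only [ha, hc]; ring
  rw [Complex.ofReal_mul, Complex.ofReal_mul, Complex.ofReal_mul, Complex.ofReal_inv, e3]
  simp only [Complex.ofReal_zero, mul_zero, Complex.exp_zero]
  push_cast
  field_simp
  linear_combination hac2

theorem integrable_exp_neg_abs {δ : ℝ≥0} (hδ : 0 < δ) :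
    Integrable (fun t : ℝ => Complex.exp (-((δ * |t| : ℝ) : ℂ))) := by
  have hδ' : (0 : ℝ) < δ := hδ
  rw [← integrableOn_univ, ← Set.Iic_union_Ioi (a := (0 : ℝ)), integrableOn_union]
  constructor
  · refine (integrableOn_exp_mul_complex_Iic (a := (δ : ℂ)) (by simpa using hδ') 0).congr_fun
      (fun v hv => ?_) measurableSet_Iic
    simp [abs_of_nonpos (Set.mem_Iic.1 hv)]
  · refine (integrableOn_exp_mul_complex_Ioi (a := -(δ : ℂ)) (by simpa using hδ') 0).congr_fun
      (fun v hv => ?_) measurableSet_Ioi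
    simp [abs_of_pos (Set.mem_Ioi.1 hv)]

/-- The characteristic function of the Cauchy distribution. -/
theorem integral_cauchyPDFReal_mul_exp {δ : ℝ≥0} (hδ : 0 < δ) (t : ℝ) :
    ∫ s : ℝ, (ProbabilityTheory.cauchyPDFReal 0 δ s : ℂ) * Complex.exp (t * s * Complex.I) =
      Complex.exp (-((δ * |t| : ℝ) : ℂ)) := by
  have hF : 𝓕 (fun t : ℝ => Complex.exp (-((δ * |t| : ℝ) : ℂ))) = fun ξ =>
      ((2 * Real.pi * ProbabilityTheory.cauchyPDFReal 0 δ (2 * Real.pi * ξ) : ℝ) : ℂ) :=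
    funext fun ξ => fourier_exp_neg_abs hδ ξ
  have hI : Integrable (𝓕 (fun t : ℝ => Complex.exp (-((δ * |t| : ℝ) : ℂ)))) := by
    rw [hF]
    exact (((ProbabilityTheory.integrable_cauchyPDFReal 0).comp_mul_left'
      (by positivity)).const_mul _).ofReal
  -- Fourier inversion for `e^{-δ|t|}`; the factor `2π` in the frequency disappears by rescaling the
  -- variable.
  have h := congrFun (Continuous.fourierInv_fourier_eq (by fun_prop)
    (integrable_exp_neg_abs hδ) hI) t
  rw [← h, hF, Real.fourierInv_eq']
  have := Measure.integral_comp_mul_left (fun s : ℝ =>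
    ((2 * Real.pi * ProbabilityTheory.cauchyPDFReal 0 δ s : ℝ) : ℂ) *
      Complex.exp (t * s * Complex.I)) (2 * Real.pi)
  have e : (fun v : ℝ => Complex.exp (((2 * Real.pi * inner ℝ v t : ℝ) : ℂ) * Complex.I) •
      ((2 * Real.pi * ProbabilityTheory.cauchyPDFReal 0 δ (2 * Real.pi * v) : ℝ) : ℂ)) =
      fun v : ℝ => ((2 * Real.pi * ProbabilityTheory.cauchyPDFReal 0 δ (2 * Real.pi * v) : ℝ) : ℂ) *
      Complex.exp (t * (2 * Real.pi * v : ℝ) * Complex.I) := by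
    ext v
    rw [smul_eq_mul, mul_comm]
    congr 2
    simp
    ring
  rw [e, this, abs_of_pos (by positivity)]
  simp only [Complex.ofReal_mul, mul_assoc, integral_const_mul]
  have hpi : (Real.pi : ℂ) ≠ 0 := by exact_mod_cast Real.pi_ne_zero
  simp
  field_simp
  simp only [mul_right_comm]

/-! ### Laplace transforms on vertical lines: Poisson bound and Plancherel. -/

/-- The Laplace transform (of a function on `(0, ∞)`, extended by zero). -/
def laplace (f : ℝ → ℂ) (z : ℂ) : ℂ := ∫ t : ℝ, f t * Complex.exp (-z * t)

theorem integrable_laplace {f : ℝ → ℂ} (h1 : Integrable f) (h0 : ∀ t ≤ 0, f t = 0) {z : ℂ}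
    (hz : 0 ≤ z.re) : Integrable fun t : ℝ => f t * Complex.exp (-z * t) := by
  refine h1.mono (h1.aestronglyMeasurable.mul (by fun_prop)) (ae_of_all _ fun t => ?_)
  rcases le_or_gt t 0 with ht | ht
  · simp [h0 t ht]
  · rw [norm_mul, Complex.norm_exp]
    refine mul_le_of_le_one_right (norm_nonneg _) (Real.exp_le_one_iff.2 ?_)
    simp
    positivity

theorem continuous_laplace {f : ℝ → ℂ} (h1 : Integrable f) (h0 : ∀ t ≤ 0, f t = 0) :
    Continuous fun p : ℝ≥0 × ℝ => laplace f (((p.1 : ℝ) : ℂ) + (p.2 : ℂ) * Complex.I) := by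
  refine continuous_of_dominated (bound := fun t => ‖f t‖) (fun p => ?_) (fun p => ?_) h1.norm ?_
  · exact h1.aestronglyMeasurable.mul (by fun_prop)
  · refine ae_of_all _ fun t => ?_
    rcases le_or_gt t 0 with ht | ht
    · simp [h0 t ht]
    · rw [norm_mul, Complex.norm_exp]
      refine mul_le_of_le_one_right (norm_nonneg _) (Real.exp_le_one_iff.2 ?_)
      simp
      positivity
  · exact ae_of_all _ fun t => by fun_prop

/-- Poisson's formula, as an upper bound, on the half-plane `Re z > r`. -/
theorem enorm_laplace_le_poisson {f : ℝ → ℂ} (h1 : Integrable f) (h0 : ∀ t ≤ 0, f t = 0)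
    {r : ℝ} (hr : 0 ≤ r) {δ : ℝ≥0} (hδ : 0 < δ) (y : ℝ) :
    ‖laplace f ((r + δ : ℝ) + y * Complex.I)‖ₑ ≤
      ∫⁻ v : ℝ, ProbabilityTheory.cauchyPDF y δ v * ‖laplace f (r + v * Complex.I)‖ₑ := by
  set P := ProbabilityTheory.cauchyPDFReal 0 δ with hP
  have hPi : Integrable P := ProbabilityTheory.integrable_cauchyPDFReal 0
  have hf := integrable_laplace h1 h0 (z := r + y * Complex.I) (by simpa using hr)
  -- Moving from `Re z = r` to `Re z = r + δ` inserts the factor `e^{-δt}`, which for `t > 0` equals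
  -- the Cauchy characteristic function at `t`. Fubini then gives a Poisson integral of `laplace f`
  -- over the line `Re z = r`.
  have e1 : laplace f ((r + δ : ℝ) + y * Complex.I) =
      ∫ t : ℝ, ∫ s : ℝ, (f t * Complex.exp (-(r + y * Complex.I) * t)) * (P s : ℂ) *
        Complex.exp (t * s * Complex.I) := by
    refine integral_congr_ae (ae_of_all _ fun t => ?_)
    simp only [mul_assoc (f t * Complex.exp (-(r + y * Complex.I) * t))]
    rw [integral_const_mul, hP, integral_cauchyPDFReal_mul_exp hδ]
    rcases le_or_gt t 0 with ht | ht
    · simp [h0 t ht]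
    · rw [abs_of_pos ht, mul_assoc, ← Complex.exp_add]
      congr 2
      push_cast
      ring
  rw [e1, integral_integral_swap]
  · refine (enorm_integral_le_lintegral_enorm _).trans ?_
    rw [← lintegral_sub_left_eq_self
      (fun v : ℝ => ProbabilityTheory.cauchyPDF y δ v * ‖laplace f (r + v * Complex.I)‖ₑ) y]
    refine lintegral_mono fun s => ?_
    have e2 : ∀ t : ℝ, (f t * Complex.exp (-(r + y * Complex.I) * t)) * (P s : ℂ) *
        Complex.exp (t * s * Complex.I) =
        (P s : ℂ) * (f t * Complex.exp (-(r + (y - s : ℝ) * Complex.I) * t)) := by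
      intro t
      have : Complex.exp (-(r + (y - s : ℝ) * Complex.I) * t) =
          Complex.exp (-(r + y * Complex.I) * t) * Complex.exp (t * s * Complex.I) := by
        rw [← Complex.exp_add]
        congr 1
        push_cast
        ring
      rw [this]
      ring
    simp only [e2]
    rw [integral_const_mul, enorm_mul]
    refine mul_le_mul' (le_of_eq ?_) le_rfl
    rw [ProbabilityTheory.cauchyPDF_def, ← ofReal_norm, Complex.norm_real, hP,
      Real.norm_of_nonneg (ProbabilityTheory.cauchyPDF_pos 0 hδ.ne' s).le]
    simp [ProbabilityTheory.cauchyPDFReal_def]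
  · have := hf.mul_prod (hPi.ofReal (𝕜 := ℂ))
    refine this.mono (this.aestronglyMeasurable.mul (by fun_prop)) (ae_of_all _ fun p => ?_)
    simp only [Function.uncurry]
    rw [norm_mul (_ * _) (Complex.exp _)]
    refine mul_le_of_le_one_right (norm_nonneg _) (le_of_eq ?_)
    rw [Complex.norm_exp]
    simp

/-- Plancherel's theorem on the vertical line `Re z = r`. -/
theorem lintegral_enorm_sq_laplace {f : ℝ → ℂ} (h1 : Integrable f) (h2 : MemLp f 2)
    (h0 : ∀ t ≤ 0, f t = 0) {r : ℝ} (hr : 0 ≤ r) :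
    ∫⁻ v : ℝ, ‖laplace f (r + v * Complex.I)‖ₑ ^ 2 =
      ENNReal.ofReal (2 * Real.pi) *
        ∫⁻ t : ℝ, ‖f t‖ₑ ^ 2 * ENNReal.ofReal (Real.exp (-2 * r * t)) := by
  set g : ℝ → ℂ := fun t => f t * Complex.exp (-(r : ℂ) * t) with hg
  have g1 : Integrable g := integrable_laplace h1 h0 (by simpa using hr)
  have g2 : MemLp g 2 := by
    refine h2.mono g1.aestronglyMeasurable (ae_of_all _ fun t => ?_)
    rcases le_or_gt t 0 with ht | ht
    · simp [hg, h0 t ht]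
    · rw [norm_mul, Complex.norm_exp]
      refine mul_le_of_le_one_right (norm_nonneg _) (Real.exp_le_one_iff.2 ?_)
      simp
      positivity
  have e1 : ∀ ξ : ℝ, 𝓕 g ξ = laplace f (r + (2 * Real.pi * ξ : ℝ) * Complex.I) := by
    intro ξ
    rw [Real.fourier_real_eq_integral_exp_smul]
    refine integral_congr_ae (ae_of_all _ fun t => ?_)
    simp only [hg, smul_eq_mul]
    rw [mul_left_comm, ← Complex.exp_add]
    congr 2
    push_cast
    ring
  have e2 := lintegral_enorm_sq_fourier_eq g1 g2
  simp only [e1] at e2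
  have hm : Measurable fun v : ℝ => ‖laplace f (r + v * Complex.I)‖ₑ ^ 2 :=
    (((continuous_laplace h1 h0).comp
      (Continuous.prodMk continuous_const continuous_id : Continuous fun v : ℝ =>
        ((⟨r, hr⟩ : ℝ≥0), v))).measurable.enorm).pow_const 2
  -- The substitution `v = 2πξ` is the source of the factor `2π` in the weight.
  have e3 : ∫⁻ ξ : ℝ, ‖laplace f (r + (2 * Real.pi * ξ : ℝ) * Complex.I)‖ₑ ^ 2 =
      ∫⁻ v, ‖laplace f (r + v * Complex.I)‖ₑ ^ 2 ∂(Measure.map (2 * Real.pi * ·) volume) :=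
    (lintegral_map hm (by fun_prop)).symm
  rw [e3, Real.map_volume_mul_left (by positivity), lintegral_smul_measure] at e2
  have e4 : ∀ t, ‖g t‖ₑ ^ 2 = ‖f t‖ₑ ^ 2 * ENNReal.ofReal (Real.exp (-2 * r * t)) := by
    intro t
    rw [hg, enorm_mul, mul_pow, ← ofReal_norm (Complex.exp _), Complex.norm_exp,
      ← ENNReal.ofReal_pow (Real.exp_nonneg _), ← Real.exp_nat_mul]
    congr 3
    simp
    ring
  simp only [e4] at e2
  rw [← e2, smul_eq_mul, ← mul_assoc, ← ENNReal.ofReal_mul (by positivity),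
    abs_of_pos (by positivity), mul_inv_cancel₀ (by positivity)]
  simp

end Fourier

/-! ### Covering arguments -/

/-- Take the least `j` whose dyadic dilate contains `v`. For `j = 0` the peak value `1/(πδ)`
suffices, with `δ ≥ x/2`; for `j > 0` minimality gives `|v - y| ≥ 2^{j-1} x`, and the quadratic
decay of the kernel is used with `δ ≤ x`. -/
theorem exists_cauchyPDF_le {x : ℝ} (hx : 0 < x) {δ : ℝ≥0} (h1 : x / 2 ≤ δ) (h2 : δ ≤ x)
    (y v : ℝ) : ∃ j : ℕ, v ∈ Metric.ball y (2 ^ j * x) ∧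
      ProbabilityTheory.cauchyPDFReal y δ v ≤ 4 * (4 ^ j)⁻¹ / (Real.pi * x) := by
  have hpi := Real.pi_pos
  have hδ : (0 : ℝ) < δ := by linarith
  have hex : ∃ j : ℕ, |v - y| < 2 ^ j * x := by
    obtain ⟨n, hn⟩ := pow_unbounded_of_one_lt (|v - y| / x) (one_lt_two)
    exact ⟨n, (div_lt_iff₀ hx).1 hn⟩
  classical
  refine ⟨Nat.find hex, by simpa [Real.dist_eq] using Nat.find_spec hex, ?_⟩
  rw [ProbabilityTheory.cauchyPDFReal_def]
  rcases h : Nat.find hex with _ | j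
  · calc Real.pi⁻¹ * δ * ((v - y) ^ 2 + (δ : ℝ) ^ 2)⁻¹
        ≤ Real.pi⁻¹ * δ * ((δ : ℝ) ^ 2)⁻¹ := by
          gcongr
          nlinarith [sq_nonneg (v - y)]
      _ = (Real.pi * δ)⁻¹ := by field_simp
      _ ≤ (Real.pi * (x / 2))⁻¹ := by gcongr
      _ ≤ 4 * (4 ^ 0)⁻¹ / (Real.pi * x) := by
          rw [pow_zero, inv_one, mul_one, inv_eq_one_div, div_le_div_iff₀ (by positivity)
            (by positivity)]
          nlinarith [mul_pos hpi hx]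
  · have hj : 2 ^ j * x ≤ |v - y| := not_lt.1 (Nat.find_min hex (h ▸ Nat.lt_succ_self j))
    have hj2 : (2 ^ j * x) ^ 2 ≤ (v - y) ^ 2 := by
      rw [← sq_abs (v - y)]
      gcongr
    calc Real.pi⁻¹ * δ * ((v - y) ^ 2 + (δ : ℝ) ^ 2)⁻¹
        ≤ Real.pi⁻¹ * x * ((2 ^ j * x) ^ 2)⁻¹ := by
          gcongr
          nlinarith [sq_nonneg (δ : ℝ)]
      _ = 4 * (4 ^ (j + 1))⁻¹ / (Real.pi * x) := by
          rw [mul_pow, ← pow_mul, mul_comm j 2, pow_mul, pow_succ (4 : ℝ) j]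
          norm_num
          field_simp

/-- A Poisson integral is controlled by the averages over the dyadic dilates of a ball. -/
theorem lintegral_cauchyPDF_mul_le {x : ℝ} (hx : 0 < x) {δ : ℝ≥0} (h1 : x / 2 ≤ δ) (h2 : δ ≤ x)
    (y : ℝ) {g : ℝ → ℝ≥0∞} (hg : Measurable g) {c : ℝ≥0∞}
    (hc : ∀ j : ℕ, ∫⁻ v in Metric.ball y (2 ^ j * x), g v ≤ c * ENNReal.ofReal (2 ^ j * x)) :
    ∫⁻ v, ProbabilityTheory.cauchyPDF y δ v * g v ≤ 3 * c := by
  have hpi := Real.pi_pos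
  calc ∫⁻ v, ProbabilityTheory.cauchyPDF y δ v * g v
      ≤ ∫⁻ v, ∑' j : ℕ, ENNReal.ofReal (4 * (4 ^ j)⁻¹ / (Real.pi * x)) *
          (Metric.ball y (2 ^ j * x)).indicator g v := by
        refine lintegral_mono fun v => ?_
        obtain ⟨j, hj, hle⟩ := exists_cauchyPDF_le hx h1 h2 y v
        refine le_trans ?_ (ENNReal.le_tsum j)
        rw [Set.indicator_of_mem hj]
        exact mul_le_mul' (ENNReal.ofReal_le_ofReal hle) le_rfl
    _ = ∑' j : ℕ, ENNReal.ofReal (4 * (4 ^ j)⁻¹ / (Real.pi * x)) *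
          ∫⁻ v in Metric.ball y (2 ^ j * x), g v := by
        rw [lintegral_tsum fun j =>
          ((hg.indicator measurableSet_ball).const_mul _).aemeasurable]
        congr 1 with j
        rw [lintegral_const_mul _ (hg.indicator measurableSet_ball),
          lintegral_indicator measurableSet_ball]
    -- The kernel contributes `4^{-j}` and the length of the ball `2^j`, which leaves a convergent
    -- geometric series of sum `8/π < 3`.
    _ ≤ ∑' j : ℕ, c * ENNReal.ofReal (4 / Real.pi * (1 / 2) ^ j) := by
        refine ENNReal.tsum_le_tsum fun j => ?_
        refine (mul_le_mul' le_rfl (hc j)).trans (le_of_eq ?_)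
        rw [mul_left_comm, ← ENNReal.ofReal_mul (by positivity)]
        congr 2
        have : (4 : ℝ) ^ j = 2 ^ j * 2 ^ j := by rw [← mul_pow]; norm_num
        rw [this, one_div_pow]
        field_simp
    _ = c * ENNReal.ofReal (8 / Real.pi) := by
        have hs : Summable fun j : ℕ => 4 / Real.pi * (1 / 2 : ℝ) ^ j :=
          summable_geometric_two.mul_left _
        rw [ENNReal.tsum_mul_left, ← ENNReal.ofReal_tsum_of_nonneg (fun j => by positivity) hs,
          tsum_mul_left, tsum_geometric_two]
        congr 2
        ring
    _ ≤ 3 * c := by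
        rw [mul_comm]
        refine mul_le_mul' ?_ le_rfl
        rw [← ENNReal.ofReal_ofNat 3]
        refine ENNReal.ofReal_le_ofReal ?_
        rw [div_le_iff₀ hpi]
        nlinarith [Real.pi_gt_three]

/-- Values of `f` up to `s/2` contribute at most `s/2` to the Poisson integral, because the kernel
has mass one. If all dyadic averages of the remaining part were at most `s/6`, that part would
contribute at most `3 · s/6 = s/2`, contradicting `hs`. -/
theorem exists_ball_of_lt_poisson {x : ℝ} (hx : 0 < x) {δ : ℝ≥0} (h1 : x / 2 ≤ δ) (h2 : δ ≤ x)
    (y : ℝ) {f : ℝ → ℝ≥0∞} (hf : Measurable f) {s : ℝ≥0∞}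
    (hs : s < ∫⁻ v, ProbabilityTheory.cauchyPDF y δ v * f v) :
    ∃ j : ℕ, s / 6 * ENNReal.ofReal (2 ^ j * x) <
      ∫⁻ v in Metric.ball y (2 ^ j * x), {v | s / 2 < f v}.indicator f v := by
  by_contra! hcon
  have hδ : δ ≠ 0 := by
    rintro rfl
    simp at h1
    linarith
  have hm : MeasurableSet {v | s / 2 < f v} := measurableSet_lt measurable_const hf
  have := lintegral_cauchyPDF_mul_le hx h1 h2 y (hf.indicator hm) hcon
  refine absurd hs (not_lt.2 ?_)
  calc ∫⁻ v, ProbabilityTheory.cauchyPDF y δ v * f v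
      ≤ ∫⁻ v, (ProbabilityTheory.cauchyPDF y δ v * {v | s / 2 < f v}.indicator f v +
          ProbabilityTheory.cauchyPDF y δ v * (s / 2)) := by
        refine lintegral_mono fun v => ?_
        simp only
        rw [← mul_add]
        refine mul_le_mul' le_rfl ?_
        by_cases h : s / 2 < f v
        · rw [Set.indicator_of_mem (by exact h)]
          exact le_self_add
        · exact (not_lt.1 h).trans le_add_self
    _ ≤ 3 * (s / 6) + s / 2 := by
        rw [lintegral_add_right _ (by fun_prop), lintegral_mul_const _ (by fun_prop),
          ProbabilityTheory.lintegral_cauchyPDF_eq_one y hδ, one_mul]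
        exact add_le_add this le_rfl
    _ = s := by
        have : 3 * (s / 6) = s / 2 := by
          rw [div_eq_mul_inv, div_eq_mul_inv, mul_left_comm]
          congr 1
          rw [show (6 : ℝ≥0∞) = 3 * 2 by norm_num, ENNReal.mul_inv (by simp) (by simp), ← mul_assoc,
            ENNReal.mul_inv_cancel (by simp) (by simp), one_mul]
        rw [this, ENNReal.add_halves]

/-- A maximal inequality for finitely many disjoint balls. -/
theorem sum_le_of_forall_exists_ball {ι : Type*} (E : Finset ι) (y x : ι → ℝ)
    (hx : ∀ k ∈ E, 0 < x k)
    (hd : (E : Set ι).PairwiseDisjoint fun k => Metric.ball (y k) (x k))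
    {g : ℝ → ℝ≥0∞} {a : ℝ≥0∞}
    (hg : ∀ k ∈ E, ∃ j : ℕ, a * ENNReal.ofReal (2 ^ j * x k) <
      ∫⁻ v in Metric.ball (y k) (2 ^ j * x k), g v) :
    a * ∑ k ∈ E, ENNReal.ofReal (2 * x k) ≤ 8 * ∫⁻ v, g v := by
  classical
  choose! j hj using hg
  set ρ : ι → ℝ := fun k => 2 ^ j k * x k with hρ
  obtain ⟨R, hR⟩ := (E.image ρ).bddAbove
  -- The selection uses the enlarged radii `ρ`. The original balls lie inside the enlarged ones,
  -- hence in the fourfold dilates of the selected ones; their own disjointness turns the sum of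
  -- lengths into the measure of a union. The factor `8` is `2 · 4`.
  obtain ⟨u, huE, hud, hu⟩ := Vitali.exists_disjoint_subfamily_covering_enlargement_ball
    (E : Set ι) y ρ R (fun k hk => hR (by simpa using ⟨k, hk, rfl⟩)) 4 (by norm_num)
  obtain ⟨U, rfl⟩ : ∃ U : Finset ι, (U : Set ι) = u :=
    ⟨(E.finite_toSet.subset huE).toFinset, by simp⟩
  have hρ0 : ∀ k ∈ E, 0 < ρ k := fun k hk => by have := hx k hk; positivity
  have hsub : (⋃ k ∈ E, Metric.ball (y k) (x k)) ⊆ ⋃ k ∈ U, Metric.ball (y k) (4 * ρ k) := by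
    refine Set.iUnion₂_subset fun k hk => ?_
    obtain ⟨b, hb, hsb⟩ := hu k hk
    refine subset_trans ?_ (Set.subset_biUnion_of_mem hb)
    refine subset_trans (Metric.ball_subset_ball ?_) hsb
    exact le_mul_of_one_le_left (hx k hk).le (one_le_pow₀ (by norm_num))
  calc a * ∑ k ∈ E, ENNReal.ofReal (2 * x k)
      = a * volume (⋃ k ∈ E, Metric.ball (y k) (x k)) := by
        rw [measure_biUnion_finset hd fun k _ => measurableSet_ball]
        simp [Real.volume_ball]
    _ ≤ a * ∑ k ∈ U, ENNReal.ofReal (8 * ρ k) := by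
        gcongr
        refine (measure_mono hsub).trans ((measure_biUnion_finset_le _ _).trans (le_of_eq ?_))
        refine Finset.sum_congr rfl fun k _ => ?_
        rw [Real.volume_ball]
        congr 1
        ring
    _ = 8 * ∑ k ∈ U, a * ENNReal.ofReal (ρ k) := by
        rw [Finset.mul_sum, Finset.mul_sum]
        refine Finset.sum_congr rfl fun k hk => ?_
        rw [ENNReal.ofReal_mul (by norm_num), mul_left_comm]
        simp
    _ ≤ 8 * ∑ k ∈ U, ∫⁻ v in Metric.ball (y k) (ρ k), g v := by
        gcongr with k hk
        exact (hj k (huE hk)).le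
    _ = 8 * ∫⁻ v in ⋃ k ∈ U, Metric.ball (y k) (ρ k), g v := by
        rw [lintegral_biUnion_finset hud fun k _ => measurableSet_ball]
    _ ≤ 8 * ∫⁻ v, g v := by
        gcongr
        exact Measure.restrict_le_self

/-! ### The Carleson embedding -/

/-- Weak-type estimate, truncated so that it can be integrated over levels. The shadows of the
points with `|laplace f| > s` are covered by fourfold dilates of disjoint ones, whence the `4 * h`
in `hC`. On a line `Re z = r` with `r < x/2` the Poisson parameter `x - r` lies between `x/2` and
`x`, whence the `h / 2` there. The constant `48` is `6 · 8`, from the level `s/6` and the maximal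
inequality. -/
theorem sum_filter_lt_laplace_le {ι : Type*} (ν : Measure ℝ≥0) {f : ℝ → ℂ}
    (h1 : Integrable f) (h0 : ∀ t ≤ 0, f t = 0) (S : Finset ι) (z : ι → ℂ)
    (hz : ∀ k ∈ S, 0 < (z k).re) (m : ι → ℝ≥0∞) (K : ℝ≥0∞)
    (hC : ∀ y h : ℝ, 0 < h →
      ∑ k ∈ S with ((z k).re ≤ 4 * h ∧ |(z k).im - y| < 4 * h), m k ≤
        K * (ENNReal.ofReal (2 * h) * ν {r | (r : ℝ) < h / 2})) (s : ℝ≥0∞) :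
    s * ∑ k ∈ S with s < ‖laplace f (z k)‖ₑ, m k ≤
      48 * K * ∫⁻ r : ℝ≥0, ∫⁻ v : ℝ,
        ({v : ℝ | s / 2 < ‖laplace f ((r : ℝ) + v * Complex.I)‖ₑ}.indicator
          (fun v => ‖laplace f ((r : ℝ) + v * Complex.I)‖ₑ) v) ∂volume ∂ν := by
  classical
  set E := S.filter fun k => s < ‖laplace f (z k)‖ₑ with hE
  set y : ι → ℝ := fun k => (z k).im
  set x : ι → ℝ := fun k => (z k).re
  have hx : ∀ k ∈ E, 0 < x k := fun k hk => hz k (Finset.mem_filter.1 hk).1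
  obtain ⟨R, hR⟩ := (E.image x).bddAbove
  obtain ⟨u, huE, hud, hu⟩ := Vitali.exists_disjoint_subfamily_covering_enlargement_ball
    (E : Set ι) y x R (fun k hk => hR (by simpa using ⟨k, hk, rfl⟩)) 4 (by norm_num)
  obtain ⟨U, rfl⟩ : ∃ U : Finset ι, (U : Set ι) = u :=
    ⟨(E.finite_toSet.subset huE).toFinset, by simp⟩
  have hcov : ∀ k ∈ E, ∃ b ∈ U, (z k).re ≤ 4 * x b ∧ |(z k).im - y b| < 4 * x b := by
    intro k hk
    obtain ⟨b, hb, hsb⟩ := hu k hk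
    refine ⟨b, hb, ?_, hsb (Metric.mem_ball_self (hx k hk))⟩
    -- Inclusion of the shadows also compares the real parts, since these are half the lengths.
    have := measure_mono (μ := volume) hsb
    rw [Real.volume_ball, Real.volume_ball] at this
    have h4 := (ENNReal.ofReal_le_ofReal_iff (by have := hx b (huE hb); positivity)).1 this
    change x k ≤ _
    linarith
  have hmeas : ∀ r : ℝ≥0, Measurable fun v : ℝ => ‖laplace f ((r : ℝ) + v * Complex.I)‖ₑ := fun r =>
    ((continuous_laplace h1 h0).comp
      (Continuous.prodMk continuous_const continuous_id : Continuous fun v : ℝ =>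
        (r, v))).measurable.enorm
  -- For fixed `r` this is the one-dimensional maximal inequality, applied to those selected points
  -- whose real part exceeds `2r`; integrating in `r` recovers `ν {r | r < x b / 2}`.
  have hfib : ∀ r : ℝ≥0, s / 6 * ∑ b ∈ U with (r : ℝ) < x b / 2, ENNReal.ofReal (2 * x b) ≤
      8 * ∫⁻ v : ℝ, {v : ℝ | s / 2 < ‖laplace f ((r : ℝ) + v * Complex.I)‖ₑ}.indicator
        (fun v => ‖laplace f ((r : ℝ) + v * Complex.I)‖ₑ) v := by
    intro r
    refine sum_le_of_forall_exists_ball _ y x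
      (fun k hk => hx k (huE (Finset.mem_filter.1 hk).1))
      (hud.subset (Finset.coe_subset.2 (Finset.filter_subset _ _))) ?_
    intro k hk
    obtain ⟨hkU, hkr⟩ := Finset.mem_filter.1 hk
    have hxk := hx k (huE hkU)
    have hr0 : (0 : ℝ) ≤ r := r.2
    have hδ : (((x k - r).toNNReal : ℝ≥0) : ℝ) = x k - r := Real.coe_toNNReal _ (by linarith)
    refine exists_ball_of_lt_poisson hxk (δ := (x k - r).toNNReal) (by rw [hδ]; linarith)
      (by rw [hδ]; linarith) (y k) (hmeas r) ?_
    refine ((Finset.mem_filter.1 (huE hkU)).2).trans_le ?_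
    have := enorm_laplace_le_poisson h1 h0 hr0 (δ := (x k - r).toNNReal)
      (Real.toNNReal_pos.2 (by linarith)) (y k)
    rw [hδ, add_sub_cancel] at this
    rwa [Complex.re_add_im] at this
  have hset : ∀ b, MeasurableSet {r : ℝ≥0 | (r : ℝ) < x b / 2} := fun b =>
    measurableSet_lt measurable_coe_nnreal_real measurable_const
  calc s * ∑ k ∈ E, m k
      ≤ s * ∑ b ∈ U, ∑ k ∈ S with ((z k).re ≤ 4 * x b ∧ |(z k).im - y b| < 4 * x b),
          m k := by
        gcongr
        simp only [Finset.sum_filter]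
        rw [Finset.sum_comm]
        refine (Finset.sum_le_sum fun k hk => ?_).trans
          (Finset.sum_le_sum_of_subset (Finset.filter_subset _ _))
        obtain ⟨b, hb, hkb⟩ := hcov k hk
        refine le_trans (le_of_eq ?_) (Finset.single_le_sum (fun _ _ => zero_le) hb)
        rw [if_pos hkb]
    _ ≤ s * ∑ b ∈ U, K * (ENNReal.ofReal (2 * x b) * ν {r | (r : ℝ) < x b / 2}) := by
        gcongr with b hb
        exact hC (y b) (x b) (hx b (huE hb))
    _ = 6 * K * ∫⁻ r : ℝ≥0, s / 6 *
          ∑ b ∈ U with (r : ℝ) < x b / 2, ENNReal.ofReal (2 * x b) ∂ν := by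
        have e : ∀ r : ℝ≥0, ∑ b ∈ U with (r : ℝ) < x b / 2, ENNReal.ofReal (2 * x b) =
            ∑ b ∈ U, {r : ℝ≥0 | (r : ℝ) < x b / 2}.indicator
              (fun _ => ENNReal.ofReal (2 * x b)) r := by
          intro r
          rw [Finset.sum_filter]
          rfl
        simp only [e]
        rw [lintegral_const_mul _ (Finset.measurable_sum _ fun b _ =>
            measurable_const.indicator (hset b)),
          lintegral_finsetSum _ fun b _ => measurable_const.indicator (hset b)]
        simp only [lintegral_indicator_const (hset _)]
        rw [← Finset.mul_sum, mul_mul_mul_comm, ENNReal.mul_div_cancel (by simp) (by simp)]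
    _ ≤ 6 * K * ∫⁻ r : ℝ≥0, 8 * ∫⁻ v : ℝ,
          {v : ℝ | s / 2 < ‖laplace f ((r : ℝ) + v * Complex.I)‖ₑ}.indicator
          (fun v => ‖laplace f ((r : ℝ) + v * Complex.I)‖ₑ) v ∂volume ∂ν := by
        exact mul_le_mul' le_rfl (lintegral_mono hfib)
    _ = _ := by
        rw [lintegral_const_mul' _ _ (by simp), ← mul_assoc]
        congr 1
        ring

/-- Layer cake: `a² = ∫₀^a 2s ds`. Only this inequality is needed. -/
theorem sq_le_lintegral_indicator_lt (a : ℝ≥0) :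
    (a : ℝ≥0∞) ^ 2 ≤ ∫⁻ s in Set.Ioi (0 : ℝ),
      2 * (ENNReal.ofReal s * if ENNReal.ofReal s < a then 1 else 0) := by
  have h : ∫⁻ s in Set.Ioo (0 : ℝ) a, ENNReal.ofReal (2 * s) = (a : ℝ≥0∞) ^ 2 := by
    rw [setLIntegral_congr Ioo_ae_eq_Ioc, ← ofReal_integral_eq_lintegral_ofReal]
    · rw [← intervalIntegral.integral_of_le a.coe_nonneg, intervalIntegral.integral_const_mul,
        integral_id]
      rw [show 2 * (((a : ℝ) ^ 2 - 0 ^ 2) / 2) = (a : ℝ) ^ 2 by ring,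
        ENNReal.ofReal_pow a.coe_nonneg, ENNReal.ofReal_coe_nnreal]
    · exact (continuous_const.mul continuous_id).integrableOn_Ioc
    · exact (ae_restrict_mem measurableSet_Ioc).mono fun s hs => by
        have := hs.1
        simp only [Pi.zero_apply]
        positivity
  rw [← h, ← lintegral_indicator measurableSet_Ioo, ← lintegral_indicator measurableSet_Ioi]
  refine lintegral_mono fun s => ?_
  by_cases hs : s ∈ Set.Ioo (0 : ℝ) a
  · rw [Set.indicator_of_mem hs, Set.indicator_of_mem (Set.mem_Ioi.2 hs.1), if_pos,
      ENNReal.ofReal_mul zero_le_two]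
    · simp
    · rw [ENNReal.ofReal_lt_coe_iff hs.1.le]
      exact hs.2
  · rw [Set.indicator_of_notMem hs]
    exact zero_le

theorem lintegral_indicator_half_lt (a : ℝ≥0) :
    ∫⁻ s in Set.Ioi (0 : ℝ), (if ENNReal.ofReal s / 2 < a then 1 else 0) = 2 * (a : ℝ≥0∞) := by
  have h : ∀ s ∈ Set.Ioi (0 : ℝ), (if ENNReal.ofReal s / 2 < a then (1 : ℝ≥0∞) else 0) =
      (Set.Ioo (0 : ℝ) (2 * a)).indicator 1 s := by
    intro s hs
    have hs0 : 0 < s := hs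
    have e : ENNReal.ofReal s / 2 = ENNReal.ofReal (s / 2) := by
      rw [ENNReal.ofReal_div_of_pos two_pos]
      simp
    rw [e]
    by_cases h : s < 2 * a
    · rw [Set.indicator_of_mem (Set.mem_Ioo.2 ⟨hs0, h⟩), if_pos]
      · rfl
      · rw [ENNReal.ofReal_lt_coe_iff (by positivity)]
        linarith
    · rw [Set.indicator_of_notMem fun hh => h hh.2, if_neg]
      rw [ENNReal.ofReal_lt_coe_iff (by positivity)]
      intro hh
      exact h (by linarith)
  rw [setLIntegral_congr_fun measurableSet_Ioi h, lintegral_indicator_one measurableSet_Ioo,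
    Measure.restrict_apply measurableSet_Ioo,
    Set.inter_eq_left.2 (fun s hs => hs.1), Real.volume_Ioo, sub_zero,
    ENNReal.ofReal_mul zero_le_two]
  simp

/-- The Carleson embedding theorem for finitely supported measures. -/
theorem sum_mul_enorm_sq_laplace_le {ι : Type*} (ν : Measure ℝ≥0) [SFinite ν] {f : ℝ → ℂ}
    (h1 : Integrable f) (h0 : ∀ t ≤ 0, f t = 0) (S : Finset ι) (z : ι → ℂ)
    (hz : ∀ k ∈ S, 0 < (z k).re) (m : ι → ℝ≥0∞) (K : ℝ≥0∞)
    (hC : ∀ y h : ℝ, 0 < h →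
      ∑ k ∈ S with ((z k).re ≤ 4 * h ∧ |(z k).im - y| < 4 * h), m k ≤
        K * (ENNReal.ofReal (2 * h) * ν {r | (r : ℝ) < h / 2})) :
    ∑ k ∈ S, m k * ‖laplace f (z k)‖ₑ ^ 2 ≤
      192 * K * ∫⁻ r : ℝ≥0, ∫⁻ v : ℝ, ‖laplace f ((r : ℝ) + v * Complex.I)‖ₑ ^ 2 ∂volume ∂ν := by
  classical
  set G : ℝ≥0 × ℝ → ℝ≥0∞ := fun p => ‖laplace f ((p.1 : ℝ) + p.2 * Complex.I)‖ₑ with hG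
  have hGm : Measurable G := (continuous_laplace h1 h0).measurable.enorm
  have hind : ∀ a : ℝ≥0∞, Measurable fun s : ℝ => if ENNReal.ofReal s < a then (1 : ℝ≥0∞) else 0 :=
    fun a => Measurable.ite (measurableSet_lt ENNReal.measurable_ofReal measurable_const)
      measurable_const measurable_const
  calc ∑ k ∈ S, m k * ‖laplace f (z k)‖ₑ ^ 2
      ≤ ∑ k ∈ S, m k * ∫⁻ s in Set.Ioi (0 : ℝ),
          2 * (ENNReal.ofReal s * if ENNReal.ofReal s < ‖laplace f (z k)‖ₑ then 1 else 0) := by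
        gcongr with k hk
        exact sq_le_lintegral_indicator_lt _
    _ = ∫⁻ s in Set.Ioi (0 : ℝ), 2 * (ENNReal.ofReal s *
          ∑ k ∈ S with ENNReal.ofReal s < ‖laplace f (z k)‖ₑ, m k) := by
        have hm : ∀ k, Measurable fun s : ℝ => 2 * (ENNReal.ofReal s *
            if ENNReal.ofReal s < ‖laplace f (z k)‖ₑ then (1 : ℝ≥0∞) else 0) := fun k =>
          (ENNReal.measurable_ofReal.mul (hind _)).const_mul _
        simp_rw [← lintegral_const_mul _ (hm _)]
        rw [← lintegral_finsetSum _ fun k _ => (hm k).const_mul _]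
        refine lintegral_congr fun s => ?_
        rw [Finset.sum_filter, Finset.mul_sum, Finset.mul_sum]
        refine Finset.sum_congr rfl fun k _ => ?_
        split_ifs
        · ring
        · simp
    _ ≤ ∫⁻ s in Set.Ioi (0 : ℝ), 2 * (48 * K * ∫⁻ p : ℝ≥0 × ℝ,
          G p * (if ENNReal.ofReal s / 2 < G p then 1 else 0) ∂(ν.prod volume)) := by
        refine lintegral_mono fun s => mul_le_mul' le_rfl ?_
        refine (sum_filter_lt_laplace_le ν h1 h0 S z hz m K hC (ENNReal.ofReal s)).trans ?_
        have hm : Measurable fun p => G p * (if ENNReal.ofReal s / 2 < G p then 1 else 0) :=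
          hGm.mul (Measurable.ite (measurableSet_lt measurable_const hGm)
            measurable_const measurable_const)
        rw [lintegral_prod _ hm.aemeasurable]
        gcongr with r v
        by_cases h : ENNReal.ofReal s / 2 < G (r, v)
        · rw [if_pos h, mul_one]
          exact Set.indicator_le_self' (fun _ _ => zero_le) _
        · rw [Set.indicator_of_notMem (by exact h)]
          exact zero_le
    _ = 96 * K * ∫⁻ s in Set.Ioi (0 : ℝ), ∫⁻ p : ℝ≥0 × ℝ,
          G p * (if ENNReal.ofReal s / 2 < G p then 1 else 0) ∂(ν.prod volume) := by
        simp_rw [← mul_assoc]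
        rw [lintegral_const_mul]
        · congr 1
          ring
        · refine Measurable.lintegral_prod_right' (f := fun q : ℝ × (ℝ≥0 × ℝ) =>
            G q.2 * (if ENNReal.ofReal q.1 / 2 < G q.2 then 1 else 0)) ?_
          exact (hGm.comp measurable_snd).mul (Measurable.ite (measurableSet_lt
            (by fun_prop) (hGm.comp measurable_snd)) measurable_const measurable_const)
    -- By Tonelli the levels are integrated first. Those with `s/2 < G p` have total length `2 * G
    -- p`; the truncation is what makes this length finite.
    _ = 96 * K * ∫⁻ p : ℝ≥0 × ℝ, 2 * G p ^ 2 ∂(ν.prod volume) := by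
        rw [lintegral_lintegral_swap]
        · congr 1
          refine lintegral_congr fun p => ?_
          rw [lintegral_const_mul]
          · have := lintegral_indicator_half_lt ‖laplace f ((p.1 : ℝ) + p.2 * Complex.I)‖₊
            rw [show G p = ((‖laplace f ((p.1 : ℝ) + p.2 * Complex.I)‖₊ : ℝ≥0) : ℝ≥0∞) from rfl,
              this]
            ring
          · exact Measurable.ite (measurableSet_lt (by fun_prop) measurable_const)
              measurable_const measurable_const
        · exact ((hGm.comp measurable_snd).mul (Measurable.ite (measurableSet_lt
            (by fun_prop) (hGm.comp measurable_snd)) measurable_const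
            measurable_const)).aemeasurable
    _ = _ := by
        rw [lintegral_const_mul _ (hGm.pow_const 2),
          lintegral_prod _ (hGm.pow_const 2).aemeasurable,
          ← mul_assoc]
        congr 1
        ring

/-! ### Zen measures -/

theorem setOf_coe_lt_eq_Iio (h : ℝ) :
    {r : ℝ≥0 | (r : ℝ) < h} = Set.Iio h.toNNReal := by
  ext r
  simp [Real.lt_toNNReal_iff_coe_lt]

theorem measure_lt_two_pow_mul_le {ν : Measure ℝ≥0} {R : ℝ≥0}
    (hR : ∀ r : ℝ≥0, 0 < r → ν (Set.Iio (2 * r)) ≤ R * ν (Set.Iio r)) {h : ℝ} (hh : 0 < h) (n : ℕ) :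
    ν {r : ℝ≥0 | (r : ℝ) < 2 ^ n * h} ≤ (R : ℝ≥0∞) ^ n * ν {r : ℝ≥0 | (r : ℝ) < h} := by
  induction n with
  | zero => simp
  | succ n ih =>
    have e := hR (2 ^ n * h).toNNReal (Real.toNNReal_pos.2 (by positivity))
    have e2 : 2 * (2 ^ n * h).toNNReal = (2 ^ (n + 1) * h).toNNReal := by
      rw [pow_succ', mul_assoc, Real.toNNReal_mul zero_le_two]
      simp
    rw [e2, ← setOf_coe_lt_eq_Iio, ← setOf_coe_lt_eq_Iio] at e
    rw [pow_succ' (R : ℝ≥0∞), mul_assoc]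
    exact e.trans (mul_le_mul' le_rfl ih)

theorem measurableSet_carlesonSquare {I : Set ℝ} (hI : I.OrdConnected) :
    MeasurableSet (carlesonSquare I) := by
  have e : carlesonSquare I = {z : ℂ | 0 ≤ z.re} ∩ {z : ℂ | z.re < volume.real I} ∩
      Complex.im ⁻¹' I := by
    ext z
    simp [carlesonSquare, and_assoc]
  rw [e]
  exact ((measurableSet_le measurable_const Complex.measurable_re).inter
    (measurableSet_lt Complex.measurable_re measurable_const)).inter
    (Complex.measurable_im hI.measurableSet)

theorem planeMeasure_carlesonSquare (ν : Measure ℝ≥0) {I : Set ℝ} (hI : I.OrdConnected) :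
    planeMeasure ν (carlesonSquare I) = ν {r : ℝ≥0 | (r : ℝ) < volume.real I} * volume I := by
  rw [planeMeasure, Measure.map_apply (by fun_prop) (measurableSet_carlesonSquare hI),
    ← Measure.prod_prod]
  congr 1
  ext p
  simp [carlesonSquare]

theorem spectralMeasure_apply {ι : Type*} (b l : ι → ℂ) {Q : Set ℂ} (hQ : MeasurableSet Q) :
    spectralMeasure b l Q = ∑' k, ENNReal.ofReal (‖b k‖ ^ 2) * Q.indicator 1 (-l k) := by
  rw [spectralMeasure, Measure.sum_apply _ hQ]
  congr 1 with k
  rw [Measure.smul_apply, Measure.dirac_apply' _ hQ, smul_eq_mul]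

/-- The Carleson condition in the form used for the embedding theorem. -/
theorem CarlesonCondition.sum_le {ι : Type*} {b l : ι → ℂ} {ν : Measure ℝ≥0} {R : ℝ≥0}
    (hR : ∀ r : ℝ≥0, 0 < r → ν (Set.Iio (2 * r)) ≤ R * ν (Set.Iio r)) (hl : ∀ k, (l k).re < 0)
    (hC : CarlesonCondition (spectralMeasure b l) ν) :
    ∃ K : ℝ≥0, ∀ (S : Finset ι) (y h : ℝ), 0 < h →
      ∑ k ∈ S with ((-l k).re ≤ 4 * h ∧ |(-l k).im - y| < 4 * h), ENNReal.ofReal (‖b k‖ ^ 2) ≤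
        K * (ENNReal.ofReal (2 * h) * ν {r | (r : ℝ) < h / 2}) := by
  obtain ⟨κ, -, hκ⟩ := hC
  refine ⟨κ * R ^ 4 * 4, fun S y h hh => ?_⟩
  set I := Metric.ball y (4 * h) with hI
  have hIo : I.OrdConnected := (convex_ball y (4 * h)).ordConnected
  have hv : volume I = ENNReal.ofReal (8 * h) := by
    rw [hI, Real.volume_ball]
    congr 1
    ring
  have hvr : volume.real I = 8 * h := by
    rw [measureReal_def, hv, ENNReal.toReal_ofReal (by positivity)]
  calc ∑ k ∈ S with ((-l k).re ≤ 4 * h ∧ |(-l k).im - y| < 4 * h), ENNReal.ofReal (‖b k‖ ^ 2)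
      ≤ spectralMeasure b l (carlesonSquare I) := by
        rw [spectralMeasure_apply b l (measurableSet_carlesonSquare hIo), Finset.sum_filter]
        refine le_trans (Finset.sum_le_sum fun k _ => ?_) (ENNReal.sum_le_tsum S)
        split_ifs with hk
        · rw [Set.indicator_of_mem]
          · simp
          · refine ⟨?_, ?_, by simpa [hI, Real.dist_eq] using hk.2⟩
            · simpa using (hl k).le
            · rw [hvr]
              linarith [hk.1]
        · exact zero_le
    -- The square over an interval of length `8h` also has depth `8h = 2⁴ · (h/2)`, so four
    -- doublings reach `h/2`.
    _ ≤ κ * (ν {r : ℝ≥0 | (r : ℝ) < 2 ^ 4 * (h / 2)} * ENNReal.ofReal (8 * h)) := by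
        refine (hκ I hIo Metric.isBounded_ball).trans (le_of_eq ?_)
        rw [planeMeasure_carlesonSquare ν hIo, hv, hvr]
        congr 5
        ring_nf
    _ ≤ κ * ((R ^ 4 * ν {r : ℝ≥0 | (r : ℝ) < h / 2}) * ENNReal.ofReal (8 * h)) := by
        gcongr
        exact measure_lt_two_pow_mul_le hR (by positivity) 4
    _ = _ := by
        rw [show 8 * h = 4 * (2 * h) by ring, ENNReal.ofReal_mul (by norm_num)]
        push_cast
        simp only [ENNReal.ofReal_ofNat]
        ring

/-! ### The weight, the Paley–Wiener isometry and norms of kernel functions. -/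

theorem measurable_weight (ν : Measure ℝ≥0) [SFinite ν] : Measurable (weight ν) := by
  refine Measurable.const_mul ?_ _
  exact Measurable.lintegral_prod_right' (f := fun p : ℝ × ℝ≥0 =>
    ENNReal.ofReal (Real.exp (-2 * (p.2 : ℝ) * p.1))) (by fun_prop)

theorem weight_ne_zero {ν : Measure ℝ≥0} (hν : ν ≠ 0) (t : ℝ) : weight ν t ≠ 0 := by
  refine mul_ne_zero (by simpa using Real.pi_pos) ?_
  rw [Ne, lintegral_eq_zero_iff (by fun_prop)]
  intro h
  apply hν
  rw [← Measure.measure_univ_eq_zero]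
  refine measure_mono_null (fun r _ => ?_) h
  simpa using Real.exp_pos _

theorem weight_antitone (ν : Measure ℝ≥0) : Antitone (weight ν) := by
  intro s t hst
  refine mul_le_mul' le_rfl (lintegral_mono fun r => ENNReal.ofReal_le_ofReal ?_)
  refine Real.exp_le_exp.2 ?_
  have := mul_le_mul_of_nonneg_left hst r.coe_nonneg
  linarith

/-- The Paley–Wiener isometry. -/
theorem lintegral_lintegral_enorm_sq_laplace (ν : Measure ℝ≥0) [SFinite ν] {f : ℝ → ℂ}
    (h1 : Integrable f) (h2 : MemLp f 2) (h0 : ∀ t ≤ 0, f t = 0) :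
    ∫⁻ r : ℝ≥0, ∫⁻ v : ℝ, ‖laplace f ((r : ℝ) + v * Complex.I)‖ₑ ^ 2 ∂volume ∂ν =
      ∫⁻ t, ‖f t‖ₑ ^ 2 * weight ν t := by
  simp_rw [fun r : ℝ≥0 => lintegral_enorm_sq_laplace h1 h2 h0 r.coe_nonneg]
  rw [lintegral_const_mul' _ _ ENNReal.ofReal_ne_top, lintegral_lintegral_swap,
    ← lintegral_const_mul' _ _ ENNReal.ofReal_ne_top]
  · refine lintegral_congr fun t => ?_
    rw [lintegral_const_mul _ (by fun_prop), weight, mul_left_comm]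
  · have hm : AEMeasurable (fun p : ℝ≥0 × ℝ => ‖f p.2‖ₑ ^ 2) (ν.prod volume) :=
      (h1.aestronglyMeasurable.comp_snd.enorm).pow_const 2
    exact hm.mul (by fun_prop)

theorem lintegral_pow_mul_exp (n : ℕ) {a : ℝ} (ha : 0 < a) :
    ∫⁻ t in Set.Ioi (0 : ℝ), ENNReal.ofReal (t ^ n * Real.exp (-(a * t))) =
      ENNReal.ofReal (n.factorial / a ^ (n + 1)) := by
  have e : ∀ t ∈ Set.Ioi (0 : ℝ), t ^ n * Real.exp (-(a * t)) =
      t ^ (((n : ℝ) + 1) - 1) * Real.exp (-(a * t)) := by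
    intro t _
    rw [add_sub_cancel_right, Real.rpow_natCast]
  have hi := Real.integral_rpow_mul_exp_neg_mul_Ioi (a := (n : ℝ) + 1) (by positivity) ha
  have hval : (1 / a) ^ ((n : ℝ) + 1) * Real.Gamma ((n : ℝ) + 1) = n.factorial / a ^ (n + 1) := by
    rw [Real.Gamma_nat_eq_factorial]
    norm_cast
    rw [one_div, inv_pow]
    field_simp
  rw [hval] at hi
  rw [← hi, ← setIntegral_congr_fun measurableSet_Ioi e, ofReal_integral_eq_lintegral_ofReal]
  · refine Integrable.of_integral_ne_zero ?_
    rw [setIntegral_congr_fun measurableSet_Ioi e, hi]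
    positivity
  · exact (ae_restrict_mem measurableSet_Ioi).mono fun t ht => by
      have : 0 < t := ht
      simp only [Pi.zero_apply]
      positivity

/-- The norm of the kernel functions in `L²_w`. -/
theorem lintegral_kernel_sq_mul_weight (ν : Measure ℝ≥0) [SFinite ν] (n : ℕ) {l : ℂ}
    (hl : 0 < l.re) :
    ∫⁻ t in Set.Ioi (0 : ℝ), ‖(t : ℂ) ^ n * Complex.exp (-l * (t : ℂ))‖ₑ ^ 2 * weight ν t =
      ENNReal.ofReal (2 * Real.pi) * ∫⁻ r : ℝ≥0,
        ENNReal.ofReal ((2 * n).factorial / (2 * (l.re + r)) ^ (2 * n + 1)) ∂ν := by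
  have e : ∀ t ∈ Set.Ioi (0 : ℝ),
      ‖(t : ℂ) ^ n * Complex.exp (-l * (t : ℂ))‖ₑ ^ 2 * weight ν t =
      ENNReal.ofReal (2 * Real.pi) * ∫⁻ r : ℝ≥0,
        ENNReal.ofReal (t ^ (2 * n) * Real.exp (-((2 * (l.re + r)) * t))) ∂ν := by
    intro t ht
    have ht : 0 < t := ht
    rw [weight, mul_left_comm, ← lintegral_const_mul _ (by fun_prop)]
    congr 2 with r
    rw [← ofReal_norm, norm_mul, Complex.norm_exp, norm_pow, Complex.norm_real,
      Real.norm_of_nonneg ht.le, ← ENNReal.ofReal_pow (by positivity),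
      ← ENNReal.ofReal_mul (by positivity), mul_pow, ← pow_mul, mul_comm n 2, mul_assoc,
      ← Real.exp_nat_mul, ← Real.exp_add]
    congr 3
    simp
    ring
  rw [setLIntegral_congr_fun measurableSet_Ioi e, lintegral_const_mul' _ _ ENNReal.ofReal_ne_top,
    lintegral_lintegral_swap (by fun_prop)]
  congr 2 with r
  rw [lintegral_pow_mul_exp _ (by have := r.coe_nonneg; positivity)]

/-- The doubling condition bounds the integrals of large negative powers. -/
theorem lintegral_inv_pow_le {ν : Measure ℝ≥0} {R : ℝ≥0}
    (hR : ∀ r : ℝ≥0, 0 < r → ν (Set.Iio (2 * r)) ≤ R * ν (Set.Iio r)) {p : ℕ}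
    (hp : 2 * R ≤ 2 ^ p) {h : ℝ} (hh : 0 < h) :
    ∫⁻ r : ℝ≥0, ENNReal.ofReal (1 / (h + r) ^ p) ∂ν ≤
      ENNReal.ofReal (2 ^ (p + 1) / h ^ p) * ν {r : ℝ≥0 | (r : ℝ) < h} := by
  have hset : ∀ a : ℝ, MeasurableSet {r : ℝ≥0 | (r : ℝ) < a} := fun a =>
    measurableSet_lt measurable_coe_nnreal_real measurable_const
  -- The least `j` with `r < 2^j h` again makes the integrand decay like `2^{-pj}`.
  have hpt : ∀ r : ℝ≥0, ∃ j : ℕ, (r : ℝ) < 2 ^ j * h ∧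
      1 / (h + r) ^ p ≤ 2 ^ p / h ^ p * ((2 ^ p)⁻¹) ^ j := by
    intro r
    have hr := r.coe_nonneg
    have hex : ∃ j : ℕ, (r : ℝ) < 2 ^ j * h := by
      obtain ⟨n, hn⟩ := pow_unbounded_of_one_lt ((r : ℝ) / h) (one_lt_two)
      exact ⟨n, (div_lt_iff₀ hh).1 hn⟩
    classical
    refine ⟨Nat.find hex, Nat.find_spec hex, ?_⟩
    rcases hj : Nat.find hex with _ | j
    · rw [pow_zero, mul_one]
      refine div_le_div₀ (by positivity) (one_le_pow₀ one_le_two) (by positivity) ?_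
      gcongr
      linarith
    · have h2 : 2 ^ j * h ≤ r := not_lt.1 (Nat.find_min hex (hj ▸ Nat.lt_succ_self j))
      calc 1 / (h + r) ^ p ≤ 1 / (2 ^ j * h) ^ p := by
            gcongr
            linarith
        _ = 2 ^ p / h ^ p * ((2 ^ p)⁻¹) ^ (j + 1) := by
            rw [mul_pow, ← pow_mul, mul_comm j p, pow_mul, pow_succ, inv_pow]
            field_simp
  -- The growth `R^j` of the measure is beaten by `2^{-pj}`. With ratio at most `1/2` the series
  -- sums to at most `2`, which turns `2^p` into `2^(p+1)`.
  have hq : (ENNReal.ofReal ((2 ^ p)⁻¹) * R : ℝ≥0∞) ≤ 2⁻¹ := by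
    rw [ENNReal.ofReal_inv_of_pos (by positivity), ENNReal.ofReal_pow zero_le_two,
      ENNReal.ofReal_ofNat]
    have : (2 * R : ℝ≥0∞) ≤ 2 ^ p := by exact_mod_cast hp
    rw [← ENNReal.div_eq_inv_mul]
    refine ENNReal.div_le_of_le_mul ?_
    rw [← ENNReal.div_eq_inv_mul, ENNReal.le_div_iff_mul_le (by simp) (by simp), mul_comm]
    exact this
  calc ∫⁻ r : ℝ≥0, ENNReal.ofReal (1 / (h + r) ^ p) ∂ν
      ≤ ∫⁻ r : ℝ≥0, ∑' j : ℕ, {r : ℝ≥0 | (r : ℝ) < 2 ^ j * h}.indicator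
          (fun _ => ENNReal.ofReal (2 ^ p / h ^ p * ((2 ^ p)⁻¹) ^ j)) r ∂ν := by
        refine lintegral_mono fun r => ?_
        obtain ⟨j, hj, hle⟩ := hpt r
        refine le_trans ?_ (ENNReal.le_tsum j)
        rw [Set.indicator_of_mem (by exact hj)]
        exact ENNReal.ofReal_le_ofReal hle
    _ = ∑' j : ℕ, ENNReal.ofReal (2 ^ p / h ^ p * ((2 ^ p)⁻¹) ^ j) *
          ν {r : ℝ≥0 | (r : ℝ) < 2 ^ j * h} := by
        rw [lintegral_tsum fun j => (measurable_const.indicator (hset _)).aemeasurable]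
        simp only [lintegral_indicator_const (hset _)]
    _ ≤ ∑' j : ℕ, (ENNReal.ofReal (2 ^ p / h ^ p) * ν {r : ℝ≥0 | (r : ℝ) < h}) * 2⁻¹ ^ j := by
        refine ENNReal.tsum_le_tsum fun j => ?_
        refine (mul_le_mul' le_rfl (measure_lt_two_pow_mul_le hR hh j)).trans ?_
        rw [ENNReal.ofReal_mul (by positivity), ENNReal.ofReal_pow (by positivity),
          ← mul_assoc, mul_assoc (ENNReal.ofReal _), ← mul_pow, mul_right_comm]
        gcongr
    _ = _ := by
        rw [ENNReal.tsum_mul_left, ENNReal.tsum_geometric, ENNReal.one_sub_inv_two, inv_inv,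
          mul_right_comm]
        congr 1
        rw [pow_succ, mul_div_right_comm, ENNReal.ofReal_mul (by positivity)]
        simp

/-! ### Riesz bases in coordinates -/

section Riesz

variable {H : Type*} [NormedAddCommGroup H] [InnerProductSpace ℂ H] {ι : Type*}

/-- The coordinate functionals `c` of the Riesz basis `φ`, with Riesz bounds `C₁` and `C₂`. -/
structure IsRieszCoord (φ : ι → H) (c : ι → H →L[ℂ] ℂ) (C₁ C₂ : ℝ) : Prop where
  pos_lower : 0 < C₁
  pos_upper : 0 < C₂
  coord_self : ∀ k, c k (φ k) = 1
  coord_of_ne : ∀ i j, i ≠ j → c i (φ j) = 0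
  expansion : ∀ x, HasSum (fun k => c k x • φ k) x
  summable : ∀ x, Summable fun k => ‖c k x‖ ^ 2
  lower : ∀ x, C₁ * ∑' k, ‖c k x‖ ^ 2 ≤ ‖x‖ ^ 2
  upper : ∀ x, ‖x‖ ^ 2 ≤ C₂ * ∑' k, ‖c k x‖ ^ 2
  exists_of_summable : ∀ a : ι → ℂ, (Summable fun k => ‖a k‖ ^ 2) → ∃ x, ∀ k, c k x = a k

/-- The Riesz inequalities are assumed only for square-summable sequences, so square-summability of
the coefficients of an arbitrary vector has to be proved: the lower bound holds for finite partial
sums, and their norms converge. -/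
theorem IsRieszBasis.exists_coord {φ : ι → H} (hφ : IsRieszBasis φ) :
    ∃ c C₁ C₂, IsRieszCoord φ c C₁ C₂ := by
  classical
  obtain ⟨⟨e, he⟩, C₁, C₂, h1, h2, hs⟩ := hφ
  have heφ : e.basis = φ := funext he
  have hself : ∀ k, e.coord k (φ k) = 1 := fun k => by
    rw [← heφ, e.ortho]
    simp
  have hne : ∀ i j, i ≠ j → e.coord i (φ j) = 0 := fun i j hij => by
    rw [← heφ, e.ortho]
    simp [hij]
  have hexp : ∀ x, HasSum (fun k => e.coord k x • φ k) x := fun x => heφ ▸ e.expansion x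
  have hcoord : ∀ (a : ι → ℂ) x, HasSum (fun k => a k • φ k) x → ∀ k, e.coord k x = a k := by
    intro a x hx k
    have h := hx.mapL (e.coord k)
    refine h.unique ?_
    have h' := hasSum_single (f := fun j => e.coord k (a j • φ j)) k (fun j hj => by
      rw [map_smul, hne k j hj.symm, smul_zero])
    rwa [map_smul, hself, smul_eq_mul, mul_one] at h'
  have hsum : ∀ x, Summable fun k => ‖e.coord k x‖ ^ 2 := by
    intro x
    have hfin : ∀ S : Finset ι, C₁ * ∑ k ∈ S, ‖e.coord k x‖ ^ 2 ≤
        ‖∑ k ∈ S, e.coord k x • φ k‖ ^ 2 := by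
      intro S
      set a : ι → ℂ := fun k => if k ∈ S then e.coord k x else 0 with ha
      have ha0 : ∀ k ∉ S, a k = 0 := fun k hk => if_neg hk
      have ht : ∑' k, ‖a k‖ ^ 2 = ∑ k ∈ S, ‖e.coord k x‖ ^ 2 := by
        rw [tsum_eq_sum (s := S) fun k hk => by simp [ha0 k hk]]
        exact Finset.sum_congr rfl fun k hk => by simp [ha, hk]
      obtain ⟨y, hy, hl, -⟩ := hs a (summable_of_ne_finset_zero (s := S) fun k hk => by
        simp [ha0 k hk])
      have hy' : HasSum (fun k => a k • φ k) (∑ k ∈ S, a k • φ k) :=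
        hasSum_sum_of_ne_finset_zero fun k hk => by simp [ha0 k hk]
      rw [hy.unique hy', ht] at hl
      refine hl.trans (le_of_eq ?_)
      congr 2
      exact Finset.sum_congr rfl fun k hk => by simp [ha, hk]
    have hlim : Tendsto (fun S : Finset ι => ‖∑ k ∈ S, e.coord k x • φ k‖ ^ 2) atTop
        (𝓝 (‖x‖ ^ 2)) := ((hexp x).norm).pow 2
    obtain ⟨S₀, hS₀⟩ := eventually_atTop.1 (hlim.eventually (gt_mem_nhds (lt_add_one _)))
    refine summable_of_sum_le (c := (‖x‖ ^ 2 + 1) / C₁) (fun k => by positivity) fun S => ?_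
    rw [le_div_iff₀ h1, mul_comm]
    -- Enlarging `S` to contain `S₀` puts the partial sum within reach of the limit, which bounds
    -- every finite sum.
    calc C₁ * ∑ k ∈ S, ‖e.coord k x‖ ^ 2 ≤ C₁ * ∑ k ∈ S ∪ S₀, ‖e.coord k x‖ ^ 2 := by
          gcongr
          exact Finset.subset_union_left
      _ ≤ _ := hfin _
      _ ≤ _ := (hS₀ _ Finset.subset_union_right).le
  refine ⟨e.coord, C₁, C₂, h1, h2, hself, hne, hexp, hsum, fun x => ?_, fun x => ?_, fun a ha => ?_⟩
  · obtain ⟨y, hy, hl, -⟩ := hs _ (hsum x)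
    rwa [hy.unique (hexp x)] at hl
  · obtain ⟨y, hy, -, hu⟩ := hs _ (hsum x)
    rwa [hy.unique (hexp x)] at hu
  · obtain ⟨y, hy, -⟩ := hs a ha
    exact ⟨y, hcoord a y hy⟩

variable {φ : ι → H} {c : ι → H →L[ℂ] ℂ} {C₁ C₂ : ℝ}

theorem IsRieszCoord.ext (h : IsRieszCoord φ c C₁ C₂) {x y : H} (hxy : ∀ k, c k x = c k y) :
    x = y := by
  have hx := h.expansion x
  simp only [hxy] at hx
  exact hx.unique (h.expansion y)

/-- An operator with eigenvectors `φ k` acts diagonally on coordinates. -/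
theorem IsRieszCoord.coord_apply (h : IsRieszCoord φ c C₁ C₂) {S : H →L[ℂ] H} {m : ι → ℂ}
    (hS : ∀ k, S (φ k) = m k • φ k) (x : H) (k : ι) : c k (S x) = m k * c k x := by
  have h1 := ((h.expansion x).mapL S).mapL (c k)
  refine h1.unique ?_
  have h' := hasSum_single (f := fun j => c k (S (c j x • φ j))) k (fun j hj => by
    rw [map_smul, hS, map_smul, map_smul, h.coord_of_ne k j hj.symm, smul_zero, smul_zero])
  rwa [map_smul, hS, map_smul, map_smul, h.coord_self, smul_eq_mul, smul_eq_mul, mul_one,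
    mul_comm] at h'

/-- Bounded sequences define diagonal operators. -/
theorem IsRieszCoord.exists_diagonal (h : IsRieszCoord φ c C₁ C₂) {m : ι → ℂ} {M : ℝ}
    (hm : ∀ k, ‖m k‖ ≤ M) : ∃ D : H →L[ℂ] H, ∀ x k, c k (D x) = m k * c k x := by
  have hle : ∀ x k, ‖m k * c k x‖ ^ 2 ≤ M ^ 2 * ‖c k x‖ ^ 2 := by
    intro x k
    rw [norm_mul, mul_pow]
    gcongr
    exact hm k
  have hs : ∀ x, Summable fun k => ‖m k * c k x‖ ^ 2 := fun x =>
    Summable.of_nonneg_of_le (fun k => by positivity) (hle x) ((h.summable x).mul_left _)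
  choose D hD using fun x => h.exists_of_summable _ (hs x)
  let L : H →ₗ[ℂ] H :=
    { toFun := D
      map_add' := fun x y => h.ext fun k => by simp [hD, mul_add]
      map_smul' := fun a x => h.ext fun k => by simp [hD, mul_left_comm] }
  refine ⟨L.mkContinuous (Real.sqrt (C₂ * M ^ 2 / C₁)) fun x => ?_, fun x k => hD x k⟩
  have h1 := h.pos_lower
  have h2 := h.pos_upper
  rw [← Real.sqrt_sq (norm_nonneg x), ← Real.sqrt_mul (by positivity)]
  refine Real.le_sqrt_of_sq_le ?_
  calc ‖D x‖ ^ 2 ≤ C₂ * ∑' k, ‖c k (D x)‖ ^ 2 := h.upper _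
    _ ≤ C₂ * ∑' k, M ^ 2 * ‖c k x‖ ^ 2 := by
        simp only [hD]
        exact mul_le_mul_of_nonneg_left
          ((hs x).tsum_le_tsum (hle x) ((h.summable x).mul_left _)) h2.le
    _ = C₂ * M ^ 2 / C₁ * (C₁ * ∑' k, ‖c k x‖ ^ 2) := by
        rw [tsum_mul_left]
        field_simp
    _ ≤ C₂ * M ^ 2 / C₁ * ‖x‖ ^ 2 := by
        gcongr
        exact h.lower x

end Riesz

/-! ### Diagonal generators -/

section Generator

variable {H : Type*} [NormedAddCommGroup H] [InnerProductSpace ℂ H] {ι : Type*}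
  {φ : ι → H} {c : ι → H →L[ℂ] ℂ} {C₁ C₂ : ℝ} {A : H →ₗ.[ℂ] H} {l : ι → ℂ} {β : ℂ}

theorem resolvent_sub_apply (hβ : β ∈ resolventSet A) {x y : H} (hxy : (x, y) ∈ A.graph) :
    resolvent A β (β • x - y) = x := by
  obtain ⟨z, hz1, hz2⟩ := A.mem_graph_iff.1 hxy
  have := (isResolventAt_resolvent hβ).1 z
  simpa only [hz1, hz2] using this

theorem resolvent_mem_graph (hβ : β ∈ resolventSet A) (x : H) :
    (resolvent A β x, β • resolvent A β x - x) ∈ A.graph := by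
  obtain ⟨h, hx⟩ := (isResolventAt_resolvent hβ).2 x
  refine A.mem_graph_iff.2 ⟨⟨_, h⟩, rfl, ?_⟩
  simp only
  rw [eq_sub_iff_add_eq, ← eq_sub_iff_add_eq']
  exact hx.symm

/-- An eigenvalue in the resolvent set would force `φ k = 0`, against `coord_self`. -/
theorem sub_ne_zero_of_mem_resolventSet (h : IsRieszCoord φ c C₁ C₂) (hA : IsEigenfamily A φ l)
    (hβ : β ∈ resolventSet A) (k : ι) : β - l k ≠ 0 := by
  intro h0
  have := resolvent_sub_apply hβ (hA k)
  rw [← sub_smul, h0, zero_smul, map_zero] at this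
  have h1 := h.coord_self k
  rw [← this, map_zero] at h1
  exact zero_ne_one h1

theorem coord_resolvent (h : IsRieszCoord φ c C₁ C₂) (hA : IsEigenfamily A φ l)
    (hβ : β ∈ resolventSet A) (x : H) (k : ι) :
    c k (resolvent A β x) = (β - l k)⁻¹ * c k x := by
  refine h.coord_apply (m := fun k => (β - l k)⁻¹) (fun j => ?_) x k
  have := resolvent_sub_apply hβ (hA j)
  rw [← sub_smul, map_smul] at this
  rw [eq_inv_smul_iff₀ (sub_ne_zero_of_mem_resolventSet h hA hβ j), this]

/-- A nonempty resolvent set makes `A` the maximal diagonal operator: no closure or core argument is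
needed, since the graph can be read off from one resolvent. -/
theorem mem_graph_iff_coord (h : IsRieszCoord φ c C₁ C₂) (hA : IsEigenfamily A φ l)
    (hβ : β ∈ resolventSet A) {x y : H} :
    (x, y) ∈ A.graph ↔ ∀ k, c k y = l k * c k x := by
  have hne := sub_ne_zero_of_mem_resolventSet h hA hβ
  constructor
  · intro hxy k
    have e := coord_resolvent h hA hβ (β • x - y) k
    rw [resolvent_sub_apply hβ hxy, eq_inv_mul_iff_mul_eq₀ (hne k), map_sub, map_smul,
      smul_eq_mul] at e
    linear_combination e
  · intro hk
    have e : resolvent A β (β • x - y) = x := h.ext fun k => by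
      rw [coord_resolvent h hA hβ, inv_mul_eq_iff_eq_mul₀ (hne k), map_sub, map_smul, hk,
        smul_eq_mul, sub_mul]
    have := resolvent_mem_graph hβ (β • x - y)
    rwa [e, sub_sub_cancel] at this

/-- For `Re l k < 0` one has `|z - l k| ≥ Re z`, so the diagonal candidate for the inverse is
bounded. -/
theorem mem_resolventSet_of_re_pos (h : IsRieszCoord φ c C₁ C₂) (hA : IsEigenfamily A φ l)
    (hβ : β ∈ resolventSet A) (hl : ∀ k, (l k).re < 0) {z : ℂ} (hz : 0 < z.re) :
    z ∈ resolventSet A := by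
  have hre : ∀ k, z.re ≤ ‖z - l k‖ := fun k => by
    refine le_trans ?_ (Complex.re_le_norm _)
    rw [Complex.sub_re]
    linarith [hl k]
  have hne : ∀ k, z - l k ≠ 0 := fun k => norm_pos_iff.1 (hz.trans_le (hre k))
  obtain ⟨D, hD⟩ := h.exists_diagonal (m := fun k => (z - l k)⁻¹) (M := z.re⁻¹) fun k => by
    rw [norm_inv]
    exact inv_anti₀ hz (hre k)
  refine ⟨D, fun x => h.ext fun k => ?_, fun y => ?_⟩
  · have := (mem_graph_iff_coord h hA hβ).1 (A.mem_graph x) k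
    rw [hD, map_sub, map_smul, this, smul_eq_mul, ← sub_mul, inv_mul_cancel_left₀ (hne k)]
  · have hg : (D y, z • D y - y) ∈ A.graph := by
      rw [mem_graph_iff_coord h hA hβ]
      intro k
      rw [map_sub, map_smul, hD, smul_eq_mul]
      have := hne k
      field_simp
      ring
    obtain ⟨w, hw1, hw2⟩ := A.mem_graph_iff.1 hg
    simp only at hw1 hw2
    refine ⟨hw1 ▸ w.2, ?_⟩
    have : (⟨D y, hw1 ▸ w.2⟩ : A.domain) = w := Subtype.ext hw1.symm
    rw [this, hw2, sub_sub_cancel]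

theorem coord_resolvent_pow (h : IsRieszCoord φ c C₁ C₂) (hA : IsEigenfamily A φ l)
    (hβ : β ∈ resolventSet A) (N : ℕ) (x : H) (k : ι) :
    c k ((resolvent A β ^ N) x) = ((β - l k) ^ N)⁻¹ * c k x := by
  induction N generalizing x with
  | zero => simp
  | succ N ih =>
    rw [pow_succ, mul_apply_eq_comp, ih, coord_resolvent h hA hβ, pow_succ, mul_inv]
    ring

/-! ### Strong continuity of the semigroup and its action on eigenvectors. -/

variable {T : ℝ → H →L[ℂ] H}

/-- Otherwise the norms blow up along a sequence decreasing to `0`, along which every orbit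
converges; this contradicts Banach–Steinhaus. -/
theorem IsC0Semigroup.exists_bound [CompleteSpace H] (hT : IsC0Semigroup T) :
    ∃ δ > 0, ∃ M, ∀ t ∈ Set.Ioo 0 δ, ‖T t‖ ≤ M := by
  by_contra! hcon
  choose t ht htn using fun n : ℕ => hcon (1 / ((n : ℝ) + 1)) (by positivity) n
  have ht0 : Tendsto t atTop (𝓝[>] 0) := by
    refine tendsto_nhdsWithin_iff.2 ⟨?_, Eventually.of_forall fun n => (ht n).1⟩
    exact squeeze_zero (fun n => (ht n).1.le) (fun n => (ht n).2.le)
      tendsto_one_div_add_atTop_nhds_zero_nat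
  obtain ⟨M, hM⟩ := banach_steinhaus (g := fun n => T (t n)) fun x => by
    have hb := ((hT.tendsto_zero x).comp ht0).norm.bddAbove_range
    obtain ⟨C, hC⟩ := hb
    exact ⟨C, fun n => hC ⟨n, rfl⟩⟩
  obtain ⟨n, hn⟩ := exists_nat_gt M
  exact absurd (hM n) (not_le.2 (hn.trans (htn n)))

theorem IsC0Semigroup.map_add_apply (hT : IsC0Semigroup T) {s t : ℝ} (hs : 0 ≤ s) (ht : 0 ≤ t)
    (x : H) : T (s + t) x = T s (T t x) := by
  rw [hT.map_add s t hs ht]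
  rfl

theorem IsC0Semigroup.continuousOn [CompleteSpace H] (hT : IsC0Semigroup T) (x : H) :
    ContinuousOn (fun t => T t x) (Set.Ici 0) := by
  have hright : ∀ t : ℝ, 0 ≤ t → ContinuousWithinAt (fun t => T t x) (Set.Ioi t) t := by
    intro t ht
    have h1 : Tendsto (fun s => T t (T (s - t) x)) (𝓝[>] t) (𝓝 (T t x)) := by
      refine ((T t).continuous.tendsto x).comp ((hT.tendsto_zero x).comp ?_)
      refine tendsto_nhdsWithin_iff.2 ⟨?_, ?_⟩
      · have : Tendsto (fun s : ℝ => s - t) (𝓝 t) (𝓝 (t - t)) := tendsto_id.sub_const t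
        rw [sub_self] at this
        exact this.mono_left nhdsWithin_le_nhds
      · filter_upwards [self_mem_nhdsWithin] with s hs
        exact Set.mem_Ioi.2 (sub_pos.2 hs)
    refine h1.congr' ?_
    filter_upwards [self_mem_nhdsWithin] with s hs
    have hs : t < s := hs
    rw [← hT.map_add_apply ht (by linarith), add_sub_cancel]
  obtain ⟨δ, hδ, M, hM⟩ := hT.exists_bound
  -- Both `T s x` and `T t x` are images under `T (s - (t - ε))` of vectors close to `y`, and that
  -- operator is bounded uniformly because `s - (t - ε)` stays in `(0, δ)`.
  have hleft : ∀ t : ℝ, 0 < t → ContinuousWithinAt (fun t => T t x) (Set.Iio t) t := by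
    intro t ht
    set ε := min (t / 2) (δ / 2) with hε
    have hε0 : 0 < ε := by positivity
    have hεt : ε < t := (min_le_left _ _).trans_lt (by linarith)
    have hεδ : ε < δ := (min_le_right _ _).trans_lt (by linarith)
    have hev : ∀ᶠ s in 𝓝[<] t, s ∈ Set.Ioo (t - ε) t := Ioo_mem_nhdsLT (by linarith)
    set y := T (t - ε) x with hy
    have hlim : Tendsto (fun s => M * ‖T (t - s) y - y‖) (𝓝[<] t) (𝓝 0) := by
      have h1 : Tendsto (fun s => T (t - s) y) (𝓝[<] t) (𝓝 y) := by
        refine (hT.tendsto_zero y).comp (tendsto_nhdsWithin_iff.2 ⟨?_, ?_⟩)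
        · have : Tendsto (fun s : ℝ => t - s) (𝓝 t) (𝓝 (t - t)) := tendsto_id.const_sub t
          rw [sub_self] at this
          exact this.mono_left nhdsWithin_le_nhds
        · filter_upwards [self_mem_nhdsWithin] with s hs
          exact Set.mem_Ioi.2 (sub_pos.2 hs)
      have := ((h1.sub_const y).norm).const_mul M
      simpa using this
    refine tendsto_iff_norm_sub_tendsto_zero.2 (squeeze_zero' (Eventually.of_forall fun _ =>
      norm_nonneg _) ?_ hlim)
    filter_upwards [hev] with s hs
    have hs1 := hs.1
    have hs2 := hs.2
    have e1 : T s x = T (s - (t - ε)) y := by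
      rw [hy, ← hT.map_add_apply (by linarith) (by linarith), sub_add_cancel]
    have e2 : T t x = T (s - (t - ε)) (T (t - s) y) := by
      rw [hy, ← hT.map_add_apply (by linarith) (by linarith),
        ← hT.map_add_apply (by linarith) (by linarith)]
      congr 2
      ring
    rw [e1, e2, ← map_sub, ← norm_neg, ← map_neg, neg_sub]
    exact (T _).le_of_opNorm_le (hM _ ⟨by linarith, by linarith⟩) _
  intro t ht
  rcases (Set.mem_Ici.1 ht).eq_or_lt with rfl | ht0
  · exact (continuousWithinAt_Ioi_iff_Ici.1 (hright 0 le_rfl))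
  · exact (continuousAt_iff_continuous_left'_right'.2
      ⟨hleft t ht0, hright t ht0.le⟩).continuousWithinAt

/-- The semigroup acts on an eigenvector of the generator by multiplication. -/
theorem IsGenerator.apply_eigenvector [CompleteSpace H] (hT : IsC0Semigroup T)
    (hA : IsGenerator A T) {x : H} {a : ℂ} (hx : (x, a • x) ∈ A.graph) {t : ℝ} (ht : 0 ≤ t) :
    T t x = Complex.exp (a * t) • x := by
  have hlim := (hA _ _).1 hx
  -- The generator gives only right derivatives; a continuous function with vanishing right
  -- derivative is constant.
  set F : ℝ → H := fun s => Complex.exp (-a * s) • T s x with hF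
  have hcont : ContinuousOn F (Set.Icc 0 t) := by
    refine ContinuousOn.smul (by fun_prop) ((hT.continuousOn x).mono Set.Icc_subset_Ici_self)
  have hderT : ∀ s ∈ Set.Ico 0 t, HasDerivWithinAt (fun s => T s x) (a • T s x) (Set.Ici s) s := by
    intro s hs
    rw [← hasDerivWithinAt_Ioi_iff_Ici, hasDerivWithinAt_iff_tendsto_slope' (by simp)]
    have h1 : Tendsto (fun h : ℝ => T s ((h : ℂ)⁻¹ • (T h x - x))) (𝓝[>] 0) (𝓝 (T s (a • x))) :=
      ((T s).continuous.tendsto _).comp hlim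
    have h2 : Tendsto (fun r : ℝ => r - s) (𝓝[>] s) (𝓝[>] 0) := by
      refine tendsto_nhdsWithin_iff.2 ⟨?_, ?_⟩
      · have : Tendsto (fun r : ℝ => r - s) (𝓝 s) (𝓝 (s - s)) := tendsto_id.sub_const s
        rw [sub_self] at this
        exact this.mono_left nhdsWithin_le_nhds
      · filter_upwards [self_mem_nhdsWithin] with r hr
        exact Set.mem_Ioi.2 (sub_pos.2 hr)
    rw [map_smul] at h1
    refine (h1.comp h2).congr' ?_
    filter_upwards [self_mem_nhdsWithin] with r hr
    have hr : s < r := hr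
    simp only [Function.comp_apply]
    rw [map_smul, map_sub, ← hT.map_add_apply hs.1 (by linarith), add_sub_cancel, slope_def_module,
      ← Complex.ofReal_inv, Complex.coe_smul]
  have hder : ∀ s ∈ Set.Ico 0 t, HasDerivWithinAt F 0 (Set.Ici s) s := by
    intro s hs
    have hexp : HasDerivWithinAt (fun s : ℝ => Complex.exp (-a * s))
        (Complex.exp (-a * s) * (-a * 1)) (Set.Ici s) s := by
      have h1 : HasDerivAt (fun z : ℂ => Complex.exp (-a * z))
          (Complex.exp (-a * s) * (-a * 1)) s :=
        ((hasDerivAt_id (s : ℂ)).const_mul (-a)).cexp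
      exact h1.comp_ofReal.hasDerivWithinAt
    have := hexp.smul (hderT s hs)
    convert this using 1
    · rfl
    rw [smul_smul, ← add_smul]
    simp
  have e := constant_of_has_deriv_right_zero hcont hder t ⟨ht, le_rfl⟩
  simp only [hF, hT.map_zero] at e
  have e2 := congrArg (fun y => Complex.exp (a * t) • y) e
  simp only [smul_smul, ← Complex.exp_add] at e2
  simpa using e2

theorem coord_semigroup [CompleteSpace H] (h : IsRieszCoord φ c C₁ C₂) (hT : IsC0Semigroup T)
    (hG : IsGenerator A T) (hA : IsEigenfamily A φ l) {t : ℝ} (ht : 0 ≤ t) (x : H) (k : ι) :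
    c k (T t x) = Complex.exp (l k * t) * c k x :=
  h.coord_apply (fun j => hG.apply_eigenvector hT (hA j) ht) x k

end Generator

/-! ### The extrapolation space in coordinates -/

section Extrapolation

variable {H : Type*} [NormedAddCommGroup H] [InnerProductSpace ℂ H] {ι : Type*}
  {φ : ι → H} {c : ι → H →L[ℂ] ℂ} {C₁ C₂ : ℝ} {A : H →ₗ.[ℂ] H} {l : ι → ℂ} {β : ℂ}
  {T : ℝ → H →L[ℂ] H}

theorem extrapolation_induction {p : Extrapolation A β → Prop} (ξ : Extrapolation A β)
    (hp : IsClosed {ξ | p ξ}) (h : ∀ x : H, p (embed A β x)) : p ξ :=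
  UniformSpace.Completion.induction_on ξ hp fun y => by
    obtain ⟨x, rfl⟩ := (toPre A β).surjective y
    exact h x

variable [CompleteSpace H]

/-- The extension of `(β - A)⁻¹` to `D(A*)'`, as a continuous linear map. -/
def extResolvent (A : H →ₗ.[ℂ] H) (β : ℂ) : Extrapolation A β →L[ℂ] H :=
  ((preResolvent A β).mkContinuous 1 fun x => (one_mul ‖x‖).ge).extend
    (UniformSpace.Completion.toComplL (𝕜 := ℂ) (E := PreExtrapolation A β))

theorem extResolvent_embed (A : H →ₗ.[ℂ] H) (β : ℂ) (x : H) :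
    extResolvent A β (embed A β x) = resolvent A β x :=
  ContinuousLinearMap.extend_eq _ UniformSpace.Completion.denseRange_coe
    (UniformSpace.Completion.isUniformInducing_coe _) (toPre A β x)

/-- By this isometry, continuity and equality in `D(A*)'` can be tested in `H`. -/
theorem norm_extResolvent (ξ : Extrapolation A β) : ‖extResolvent A β ξ‖ = ‖ξ‖ := by
  refine extrapolation_induction (p := fun ξ => ‖extResolvent A β ξ‖ = ‖ξ‖) ξ
    (isClosed_eq (by fun_prop) (by fun_prop)) fun x => ?_
  rw [extResolvent_embed, embed, UniformSpace.Completion.norm_coe, norm_toPre]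

theorem isometry_extResolvent : Isometry (extResolvent A β) :=
  AddMonoidHomClass.isometry_of_norm _ norm_extResolvent

theorem continuous_embed (A : H →ₗ.[ℂ] H) (β : ℂ) : Continuous (embed A β) := by
  refine (isometry_extResolvent (A := A) (β := β)).isEmbedding.continuous_iff.2 ?_
  have : extResolvent A β ∘ embed A β = resolvent A β := funext (extResolvent_embed A β)
  rw [this]
  exact (resolvent A β).continuous

theorem extResolvent_extend (hT : IsC0Semigroup T) (hG : IsGenerator A T)
    (hβ : β ∈ resolventSet A) {t : ℝ} (ht : 0 ≤ t) (ξ : Extrapolation A β) :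
    extResolvent A β (extend A β (T t) ξ) = T t (extResolvent A β ξ) := by
  refine extrapolation_induction (p := fun ξ => extResolvent A β (extend A β (T t) ξ) =
    T t (extResolvent A β ξ)) ξ (isClosed_eq ((extResolvent A β).continuous.comp
    UniformSpace.Completion.continuous_map) (by fun_prop)) fun x => ?_
  rw [extend_embed A β _ (resolvent_comm hT hG hβ ht), extResolvent_embed, extResolvent_embed,
    resolvent_comm hT hG hβ ht]

theorem coord_extendToH_resolvent_pow (h : IsRieszCoord φ c C₁ C₂) (hA : IsEigenfamily A φ l)
    (hβ : β ∈ resolventSet A) {z : ℂ} (hz : z ∈ resolventSet A) (n : ℕ) (ξ : Extrapolation A β)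
    (k : ι) : c k (extendToH A β (resolvent A z ^ (n + 1)) ξ) =
      ((z - l k) ^ (n + 1))⁻¹ * ((β - l k) * c k (extResolvent A β ξ)) := by
  refine extrapolation_induction (p := fun ξ => c k (extendToH A β (resolvent A z ^ (n + 1)) ξ) =
    ((z - l k) ^ (n + 1))⁻¹ * ((β - l k) * c k (extResolvent A β ξ))) ξ
    (isClosed_eq ((c k).continuous.comp
    UniformSpace.Completion.continuous_extension) (by fun_prop)) fun x => ?_
  have e : extendToH A β (resolvent A z ^ (n + 1)) (embed A β x) = (resolvent A z ^ (n + 1)) x :=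
    UniformSpace.Completion.extension_coe (uniformContinuous_resolvent_pow hβ hz n) _
  rw [e, coord_resolvent_pow h hA hz, extResolvent_embed, coord_resolvent h hA hβ,
    mul_inv_cancel_left₀ (sub_ne_zero_of_mem_resolventSet h hA hβ k)]

theorem continuousOn_extend (hT : IsC0Semigroup T) (hG : IsGenerator A T)
    (hβ : β ∈ resolventSet A) (ξ : Extrapolation A β) :
    ContinuousOn (fun t => extend A β (T t) ξ) (Set.Ici 0) := by
  refine (isometry_extResolvent (A := A) (β := β)).isEmbedding.continuousOn_iff.2 ?_
  exact (hT.continuousOn (extResolvent A β ξ)).congr fun t ht => extResolvent_extend hT hG hβ ht ξ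

theorem extend_smul (hT : IsC0Semigroup T) (hG : IsGenerator A T)
    (hβ : β ∈ resolventSet A) {t : ℝ} (ht : 0 ≤ t) (a : ℂ) (ξ : Extrapolation A β) :
    extend A β (T t) (a • ξ) = a • extend A β (T t) ξ := by
  refine isometry_extResolvent.injective ?_
  rw [map_smul, extResolvent_extend hT hG hβ ht, extResolvent_extend hT hG hβ ht, map_smul,
    map_smul]

/-- The `k`-th coordinate of an element of `D(A*)'`. -/
def extCoord (A : H →ₗ.[ℂ] H) (β : ℂ) (c : ι → H →L[ℂ] ℂ) (l : ι → ℂ) (k : ι) :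
    Extrapolation A β →L[ℂ] ℂ :=
  (β - l k) • (c k).comp (extResolvent A β)

theorem extCoord_apply (ξ : Extrapolation A β) (k : ι) :
    extCoord A β c l k ξ = (β - l k) * c k (extResolvent A β ξ) := rfl

theorem extCoord_embed (h : IsRieszCoord φ c C₁ C₂) (hA : IsEigenfamily A φ l)
    (hβ : β ∈ resolventSet A) (x : H) (k : ι) : extCoord A β c l k (embed A β x) = c k x := by
  rw [extCoord_apply, extResolvent_embed, coord_resolvent h hA hβ,
    mul_inv_cancel_left₀ (sub_ne_zero_of_mem_resolventSet h hA hβ k)]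

theorem extCoord_ext (h : IsRieszCoord φ c C₁ C₂) (hA : IsEigenfamily A φ l)
    (hβ : β ∈ resolventSet A) {ξ η : Extrapolation A β}
    (hk : ∀ k, extCoord A β c l k ξ = extCoord A β c l k η) : ξ = η := by
  refine isometry_extResolvent.injective (h.ext fun k => ?_)
  exact mul_left_cancel₀ (sub_ne_zero_of_mem_resolventSet h hA hβ k) (hk k)

theorem extCoord_hasSum (h : IsRieszCoord φ c C₁ C₂) (hA : IsEigenfamily A φ l)
    (hβ : β ∈ resolventSet A) {b : ι → ℂ} {ξ : Extrapolation A β}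
    (hb : HasSum (fun k => b k • embed A β (φ k)) ξ) (k : ι) : extCoord A β c l k ξ = b k := by
  refine (hb.mapL (extCoord A β c l k)).unique ?_
  have h' := hasSum_single (f := fun j => extCoord A β c l k (b j • embed A β (φ j))) k
    (fun j hj => by
      rw [map_smul, extCoord_embed h hA hβ, h.coord_of_ne k j hj.symm, smul_zero])
  rwa [map_smul, extCoord_embed h hA hβ, h.coord_self, smul_eq_mul, mul_one] at h'

theorem extCoord_extend (h : IsRieszCoord φ c C₁ C₂) (hT : IsC0Semigroup T)
    (hG : IsGenerator A T) (hA : IsEigenfamily A φ l) (hβ : β ∈ resolventSet A) {t : ℝ}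
    (ht : 0 ≤ t) (ξ : Extrapolation A β) (k : ι) :
    extCoord A β c l k (extend A β (T t) ξ) =
      Complex.exp (l k * t) * extCoord A β c l k ξ := by
  rw [extCoord_apply, extResolvent_extend hT hG hβ ht, coord_semigroup h hT hG hA ht,
    extCoord_apply, mul_left_comm]

/-- The input-to-state integrand is integrable, for integrable inputs. -/
theorem integrableOn_extend (hT : IsC0Semigroup T) (hG : IsGenerator A T)
    (hβ : β ∈ resolventSet A) (B : ℂ →L[ℂ] Extrapolation A β) {u : ℝ → ℂ} {τ : ℝ}
    (hu : IntegrableOn u (Set.Ioc 0 τ)) :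
    IntegrableOn (fun t => extend A β (T t) (B (u t))) (Set.Ioc 0 τ) := by
  -- The integrand is `u t` times the orbit of `B 1`, which is continuous on the compact interval.
  have h1 := ((continuousOn_extend hT hG hβ (B 1)).mono (Set.Icc_subset_Ici_self : Set.Icc 0 τ ⊆ _))
  have h2 := hu.smul_continuousOn_of_subset h1 measurableSet_Ioc isCompact_Icc
    Set.Ioc_subset_Icc_self
  refine h2.congr_fun (fun t ht => ?_) measurableSet_Ioc
  simp only
  rw [← extend_smul hT hG hβ ht.1.le, ← map_smul, smul_eq_mul, mul_one]

theorem extCoord_integral (h : IsRieszCoord φ c C₁ C₂) (hT : IsC0Semigroup T)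
    (hG : IsGenerator A T) (hA : IsEigenfamily A φ l) (hβ : β ∈ resolventSet A)
    {B : ℂ →L[ℂ] Extrapolation A β} {b : ι → ℂ}
    (hb : HasSum (fun k => b k • embed A β (φ k)) (B 1)) {u : ℝ → ℂ} {τ : ℝ}
    (hu : IntegrableOn (fun t => extend A β (T t) (B (u t))) (Set.Ioc 0 τ)) (k : ι) :
    extCoord A β c l k (∫ t in Set.Ioc 0 τ, extend A β (T t) (B (u t))) =
      b k * ∫ t in Set.Ioc 0 τ, u t * Complex.exp (l k * t) := by
  rw [← ContinuousLinearMap.integral_comp_comm _ hu, ← integral_const_mul]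
  refine setIntegral_congr_fun measurableSet_Ioc fun t ht => ?_
  have e : B (u t) = u t • B 1 := by rw [← map_smul, smul_eq_mul, mul_one]
  rw [extCoord_extend h hT hG hA hβ ht.1.le, e, map_smul, extCoord_hasSum h hA hβ hb, smul_eq_mul]
  ring

end Extrapolation

/-! ### Inputs in `L²_w` -/

theorem eLpNorm_sq_weightMeasure (ν : Measure ℝ≥0) [SFinite ν] {u : ℝ → ℂ}
    (hu : AEStronglyMeasurable u (volume.restrict (Set.Ioi 0))) :
    eLpNorm u 2 (weightMeasure ν) ^ 2 =
      ∫⁻ t in Set.Ioi (0 : ℝ), ‖u t‖ₑ ^ 2 * weight ν t := by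
  have e : eLpNorm u 2 (weightMeasure ν) ^ 2 = ∫⁻ t, ‖u t‖ₑ ^ 2 ∂(weightMeasure ν) := by
    rw [eLpNorm_eq_lintegral_rpow_enorm_toReal (by norm_num) (by norm_num)]
    simp only [ENNReal.toReal_ofNat, one_div, ENNReal.rpow_ofNat]
    rw [← ENNReal.rpow_natCast, ← ENNReal.rpow_mul]
    norm_num
  rw [e, weightMeasure, lintegral_withDensity_eq_lintegral_mul₀ (measurable_weight ν).aemeasurable
    (hu.enorm.pow_const 2)]
  simp only [Pi.mul_apply, mul_comm]

section Input

variable {ν : Measure ℝ≥0} [SFinite ν] {u : ℝ → ℂ}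

theorem aestronglyMeasurable_of_weightMeasure (h0 : ν ≠ 0)
    (hu : AEStronglyMeasurable u (weightMeasure ν)) :
    AEStronglyMeasurable u (volume.restrict (Set.Ioi 0)) :=
  hu.mono_ac (withDensity_absolutelyContinuous' (measurable_weight ν).aemeasurable
    (ae_of_all _ fun t => weight_ne_zero h0 t))

/-- The weight is decreasing and nonzero, hence at least `weight ν τ` on the interval. -/
theorem memLp_restrict_Ioc (h0 : ν ≠ 0) (hu : MemLp u 2 (weightMeasure ν)) {a : ℝ} (ha : 0 ≤ a)
    (τ : ℝ) : MemLp u 2 (volume.restrict (Set.Ioc a τ)) := by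
  have hm := aestronglyMeasurable_of_weightMeasure h0 hu.1
  have hsub : Set.Ioc a τ ⊆ Set.Ioi 0 := fun t ht => ha.trans_lt ht.1
  refine ⟨hm.mono_measure (Measure.restrict_mono hsub le_rfl), ?_⟩
  rw [eLpNorm_lt_top_iff_lintegral_rpow_enorm_lt_top (by norm_num) (by norm_num)]
  simp only [ENNReal.toReal_ofNat, ENNReal.rpow_ofNat]
  have hfin : ∫⁻ t in Set.Ioi (0 : ℝ), ‖u t‖ₑ ^ 2 * weight ν t < ∞ := by
    rw [← eLpNorm_sq_weightMeasure ν hm]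
    exact ENNReal.pow_lt_top hu.2
  have hle : weight ν τ * ∫⁻ t in Set.Ioc a τ, ‖u t‖ₑ ^ 2 ≤
      ∫⁻ t in Set.Ioi (0 : ℝ), ‖u t‖ₑ ^ 2 * weight ν t := by
    rw [mul_comm]
    refine (lintegral_mul_const_le _ _).trans ?_
    refine le_trans (setLIntegral_mono_ae' measurableSet_Ioc (ae_of_all _ fun t ht => ?_))
      (lintegral_mono_set hsub)
    exact mul_le_mul' le_rfl (weight_antitone ν ht.2)
  exact ENNReal.lt_top_of_mul_ne_top_right (hle.trans_lt hfin).ne (weight_ne_zero h0 τ)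

/-- The Carleson embedding for inputs restricted to bounded intervals. -/
theorem sum_mul_enorm_sq_setIntegral_le {ι : Type*} (h0 : ν ≠ 0)
    (hu : MemLp u 2 (weightMeasure ν)) {b l : ι → ℂ} (hl : ∀ k, (l k).re < 0) {K : ℝ≥0}
    (hK : ∀ (S : Finset ι) (y h : ℝ), 0 < h →
      ∑ k ∈ S with ((-l k).re ≤ 4 * h ∧ |(-l k).im - y| < 4 * h), ENNReal.ofReal (‖b k‖ ^ 2) ≤
        K * (ENNReal.ofReal (2 * h) * ν {r | (r : ℝ) < h / 2}))
    {a : ℝ} (ha : 0 ≤ a) (τ : ℝ) (S : Finset ι) :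
    ∑ k ∈ S, ENNReal.ofReal (‖b k * ∫ t in Set.Ioc a τ, u t * Complex.exp (l k * t)‖ ^ 2) ≤
      192 * K * ∫⁻ t in Set.Ioc a τ, ‖u t‖ₑ ^ 2 * weight ν t := by
  have h2 := memLp_restrict_Ioc h0 hu ha τ
  set f : ℝ → ℂ := (Set.Ioc a τ).indicator u with hf
  have f2 : MemLp f 2 := (memLp_indicator_iff_restrict measurableSet_Ioc).2 h2
  have f1 : Integrable f :=
    (integrable_indicator_iff measurableSet_Ioc).2 (h2.integrable (by norm_num))
  have f0 : ∀ t ≤ 0, f t = 0 := fun t ht =>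
    Set.indicator_of_notMem (fun h => absurd (ha.trans_lt h.1) (not_lt.2 ht)) _
  have e := sum_mul_enorm_sq_laplace_le ν f1 f0 S (fun k => -l k)
    (fun k _ => by simpa using hl k) (fun k => ENNReal.ofReal (‖b k‖ ^ 2)) K (hK S)
  rw [lintegral_lintegral_enorm_sq_laplace ν f1 f2 f0] at e
  have e1 : ∫⁻ t, ‖f t‖ₑ ^ 2 * weight ν t = ∫⁻ t in Set.Ioc a τ, ‖u t‖ₑ ^ 2 * weight ν t := by
    rw [← lintegral_indicator measurableSet_Ioc]
    refine lintegral_congr fun t => ?_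
    by_cases ht : t ∈ Set.Ioc a τ
    · rw [hf, Set.indicator_of_mem ht, Set.indicator_of_mem ht]
    · rw [hf, Set.indicator_of_notMem ht, Set.indicator_of_notMem ht]
      simp
  rw [e1] at e
  refine le_trans (le_of_eq (Finset.sum_congr rfl fun k _ => ?_)) e
  have e2 : laplace f (-l k) = ∫ t in Set.Ioc a τ, u t * Complex.exp (l k * t) := by
    rw [laplace, ← integral_indicator measurableSet_Ioc]
    refine integral_congr_ae (ae_of_all _ fun t => ?_)
    by_cases ht : t ∈ Set.Ioc a τ
    · simp [hf, Set.indicator_of_mem ht]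
    · simp [hf, Set.indicator_of_notMem ht]
  rw [e2, norm_mul, mul_pow, ENNReal.ofReal_mul (by positivity),
    ENNReal.ofReal_pow (norm_nonneg _), ENNReal.ofReal_pow (norm_nonneg _), ofReal_norm,
    ofReal_norm]

end Input

/-! ### The implications -/

section Main

variable {H : Type*} [NormedAddCommGroup H] [InnerProductSpace ℂ H] {ι : Type*}
  {φ : ι → H} {c : ι → H →L[ℂ] ℂ} {C₁ C₂ : ℝ} {A : H →ₗ.[ℂ] H} {l b : ι → ℂ} {β : ℂ}
  {T : ℝ → H →L[ℂ] H} {B : ℂ →L[ℂ] Extrapolation A β} {ν : Measure ℝ≥0} [SFinite ν]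

/-- A bounded piece of the input produces a state in `H`. -/
theorem exists_state_of_carleson (h : IsRieszCoord φ c C₁ C₂) (hl : ∀ k, (l k).re < 0)
    (h0 : ν ≠ 0) {K : ℝ≥0}
    (hK : ∀ (S : Finset ι) (y h : ℝ), 0 < h →
      ∑ k ∈ S with ((-l k).re ≤ 4 * h ∧ |(-l k).im - y| < 4 * h), ENNReal.ofReal (‖b k‖ ^ 2) ≤
        K * (ENNReal.ofReal (2 * h) * ν {r | (r : ℝ) < h / 2}))
    {u : ℝ → ℂ} (hu : MemLp u 2 (weightMeasure ν)) {a : ℝ} (ha : 0 ≤ a) (τ : ℝ) :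
    ∃ x : H, (∀ k, c k x = b k * ∫ t in Set.Ioc a τ, u t * Complex.exp (l k * t)) ∧
      ‖x‖ ^ 2 ≤ C₂ * (192 * K) *
        (∫⁻ t in Set.Ioi a, ‖u t‖ₑ ^ 2 * weight ν t).toReal := by
  have hm := aestronglyMeasurable_of_weightMeasure h0 hu.1
  have hfin : ∫⁻ t in Set.Ioi a, ‖u t‖ₑ ^ 2 * weight ν t ≠ ∞ := by
    refine ((lintegral_mono_set (Set.Ioi_subset_Ioi ha)).trans_lt ?_).ne
    rw [← eLpNorm_sq_weightMeasure ν hm]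
    exact ENNReal.pow_lt_top hu.2
  set s : ι → ℂ := fun k => b k * ∫ t in Set.Ioc a τ, u t * Complex.exp (l k * t) with hs
  have hS : ∀ S : Finset ι, ∑ k ∈ S, ‖s k‖ ^ 2 ≤ 192 * K *
      (∫⁻ t in Set.Ioi a, ‖u t‖ₑ ^ 2 * weight ν t).toReal := by
    intro S
    have e := (sum_mul_enorm_sq_setIntegral_le h0 hu hl hK ha τ S).trans
      (mul_le_mul' le_rfl (lintegral_mono_set Set.Ioc_subset_Ioi_self))
    rw [← ENNReal.ofReal_sum_of_nonneg fun k _ => by positivity] at e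
    have e2 := ENNReal.toReal_mono (by finiteness) e
    rw [ENNReal.toReal_ofReal (by positivity)] at e2
    simpa [hs] using e2
  have hsum : Summable fun k => ‖s k‖ ^ 2 := summable_of_sum_le (fun k => by positivity) hS
  obtain ⟨x, hx⟩ := h.exists_of_summable s hsum
  refine ⟨x, hx, (h.upper x).trans ?_⟩
  rw [mul_assoc]
  refine mul_le_mul_of_nonneg_left ?_ h.pos_upper.le
  simp only [hx]
  exact hsum.tsum_le_of_sum_le hS

variable [CompleteSpace H]

theorem tendsto_setIntegral_Ioc_pow_mul_exp (n : ℕ) {z : ℂ} (hz : 0 < z.re) :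
    Tendsto (fun τ : ℝ => ∫ t in Set.Ioc 0 τ, (t : ℂ) ^ n * Complex.exp (-z * t)) atTop
      (𝓝 (n.factorial * (z ^ (n + 1))⁻¹)) := by
  have hz0 : z ≠ 0 := fun h => by simp [h] at hz
  have hdecay : ∀ m : ℕ, Tendsto (fun τ : ℝ => (τ : ℂ) ^ m * Complex.exp (-z * τ)) atTop (𝓝 0) := by
    intro m
    refine tendsto_zero_iff_norm_tendsto_zero.2
      ((tendsto_rpow_mul_exp_neg_mul_atTop_nhds_zero m z.re hz).congr' ?_)
    filter_upwards [eventually_ge_atTop 0] with τ hτ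
    rw [norm_mul, norm_pow, Complex.norm_real, Real.norm_of_nonneg hτ, Complex.norm_exp,
      Real.rpow_natCast]
    simp
  have hexp : ∀ t : ℝ, HasDerivAt (fun t : ℝ => Complex.exp (-z * t))
      (Complex.exp (-z * t) * (-z * 1)) t := fun t =>
    (((hasDerivAt_id (t : ℂ)).const_mul (-z)).cexp).comp_ofReal
  suffices hI : Tendsto (fun τ : ℝ => ∫ t in (0 : ℝ)..τ, (t : ℂ) ^ n * Complex.exp (-z * t)) atTop
      (𝓝 (n.factorial * (z ^ (n + 1))⁻¹)) by
    refine hI.congr' ?_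
    filter_upwards [eventually_ge_atTop 0] with τ hτ
    exact intervalIntegral.integral_of_le hτ
  have hii : ∀ (m : ℕ) (τ : ℝ), IntervalIntegrable
      (fun t : ℝ => (t : ℂ) ^ m * Complex.exp (-z * t)) volume 0 τ := fun m τ =>
    Continuous.intervalIntegrable (by fun_prop) _ _
  induction n with
  | zero =>
    have e : ∀ τ : ℝ, ∫ t in (0 : ℝ)..τ, (t : ℂ) ^ 0 * Complex.exp (-z * t) =
        z⁻¹ - z⁻¹ * ((τ : ℂ) ^ 0 * Complex.exp (-z * τ)) := by
      intro τ
      rw [intervalIntegral.integral_eq_sub_of_hasDerivAt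
        (f := fun t : ℝ => -z⁻¹ * Complex.exp (-z * t)) (fun t _ => ?_) (hii 0 τ)]
      · simp
        ring
      · refine ((hexp t).const_mul (-z⁻¹)).congr_deriv ?_
        rw [pow_zero]
        field_simp
    simp only [e]
    simpa using ((hdecay 0).const_mul z⁻¹).const_sub z⁻¹
  | succ n ih =>
    have e : ∀ τ : ℝ, ∫ t in (0 : ℝ)..τ, (t : ℂ) ^ (n + 1) * Complex.exp (-z * t) =
        (n + 1) * z⁻¹ * (∫ t in (0 : ℝ)..τ, (t : ℂ) ^ n * Complex.exp (-z * t)) -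
          z⁻¹ * ((τ : ℂ) ^ (n + 1) * Complex.exp (-z * τ)) := by
      intro τ
      have h1 := intervalIntegral.integral_eq_sub_of_hasDerivAt (a := 0) (b := τ)
        (f := fun t : ℝ => z⁻¹ * ((t : ℂ) ^ (n + 1) * Complex.exp (-z * t)))
        (f' := fun t : ℝ => (n + 1) * z⁻¹ * ((t : ℂ) ^ n * Complex.exp (-z * t)) -
          (t : ℂ) ^ (n + 1) * Complex.exp (-z * t)) (fun t _ => ?_)
        (((hii n τ).const_mul _).sub (hii (n + 1) τ))
      · rw [intervalIntegral.integral_sub ((hii n τ).const_mul _) (hii (n + 1) τ),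
          intervalIntegral.integral_const_mul] at h1
        simp only [Complex.ofReal_zero, ne_eq, Nat.add_eq_zero_iff, one_ne_zero, and_false,
          not_false_eq_true, zero_pow, zero_mul, mul_zero, sub_zero] at h1
        linear_combination -h1
      · have hp : HasDerivAt (fun t : ℝ => (t : ℂ) ^ (n + 1)) (((n + 1 : ℕ) : ℂ) * (t : ℂ) ^ n) t :=
          (hasDerivAt_pow (n + 1) (t : ℂ)).comp_ofReal
        refine ((hp.mul (hexp t)).const_mul z⁻¹).congr_deriv ?_
        push_cast
        field_simp
        ring
    simp only [e]
    have := (ih.const_mul ((n + 1) * z⁻¹)).sub ((hdecay (n + 1)).const_mul z⁻¹)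
    convert this using 2
    rw [Nat.factorial_succ]
    push_cast
    field_simp
    ring

/-- The input `t^n e^{-zt}` is tested; coordinatewise its state is `n!` times the resolvent power,
and the factor `n! ≥ 1` is discarded. -/
theorem IsAdmissible.resolventBound (h : IsRieszCoord φ c C₁ C₂) (hT : IsC0Semigroup T)
    (hG : IsGenerator A T) (hA : IsEigenfamily A φ l) (hl : ∀ k, (l k).re < 0)
    (hβ : β ∈ resolventSet A) (hb : HasSum (fun k => b k • embed A β (φ k)) (B 1))
    (hadm : IsAdmissible A T β B ν) (n : ℕ) : ResolventBound A β B ν (n + 1) := by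
  obtain ⟨m, hm, hadm⟩ := hadm
  refine ⟨(m ^ 2).toNNReal, Real.toNNReal_pos.2 (by positivity), fun z hz => ?_⟩
  rw [Nat.add_sub_cancel]
  set u : ℝ → ℂ := fun t => (t : ℂ) ^ n * Complex.exp (-z * t) with hu
  have huc : Continuous u := by fun_prop
  have hsq := eLpNorm_sq_weightMeasure ν (u := u) huc.aestronglyMeasurable
  change _ ≤ _ * ∫⁻ t in Set.Ioi (0 : ℝ), ‖u t‖ₑ ^ 2 * weight ν t
  rw [← hsq]
  -- For an input outside `L²_w` the right-hand side is infinite, as the constant is nonzero.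
  by_cases htop : eLpNorm u 2 (weightMeasure ν) = ∞
  · rw [htop, ENNReal.top_pow two_ne_zero, ENNReal.mul_top]
    · exact le_top
    · simpa using hm.ne'
  obtain ⟨x, ⟨hker, hlim⟩, hx⟩ := hadm u ⟨huc.aestronglyMeasurable, lt_top_iff_ne_top.2 htop⟩
  have hzρ := mem_resolventSet_of_re_pos h hA hβ hl hz
  have hcx : ∀ k, c k x = b k * (n.factorial * ((z - l k) ^ (n + 1))⁻¹) := by
    intro k
    have h1 := ((extCoord A β c l k).continuous.tendsto _).comp hlim
    rw [extCoord_embed h hA hβ] at h1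
    refine tendsto_nhds_unique h1 ?_
    have h2 := (tendsto_setIntegral_Ioc_pow_mul_exp n (z := z - l k)
      (by rw [Complex.sub_re]; linarith [hl k])).const_mul (b k)
    refine h2.congr fun τ => ?_
    rw [Function.comp_apply, extCoord_integral h hT hG hA hβ hb (hker τ)]
    congr 1
    refine setIntegral_congr_fun measurableSet_Ioc fun t _ => ?_
    simp only [hu]
    rw [mul_assoc, ← Complex.exp_add]
    congr 2
    ring
  set y := extendToH A β (resolvent A z ^ (n + 1)) (B 1) with hy
  have hcy : ∀ k, c k y = ((z - l k) ^ (n + 1))⁻¹ * b k := fun k => by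
    rw [hy, coord_extendToH_resolvent_pow h hA hβ hzρ, ← extCoord_apply,
      extCoord_hasSum h hA hβ hb]
  have hxy : x = (n.factorial : ℂ) • y := h.ext fun k => by
    rw [hcx, map_smul, hcy, smul_eq_mul]
    ring
  have hnorm : ‖y‖ ≤ m * (eLpNorm u 2 (weightMeasure ν)).toReal := by
    refine le_trans ?_ hx
    rw [hxy, norm_smul, Complex.norm_natCast]
    refine le_mul_of_one_le_left (norm_nonneg _) ?_
    exact_mod_cast n.factorial_pos
  rw [← ofReal_norm, ← ENNReal.ofReal_pow (norm_nonneg _)]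
  calc ENNReal.ofReal (‖y‖ ^ 2)
      ≤ ENNReal.ofReal ((m * (eLpNorm u 2 (weightMeasure ν)).toReal) ^ 2) := by gcongr
    _ = _ := by
        rw [mul_pow, ENNReal.ofReal_mul (by positivity), ENNReal.ofReal_pow ENNReal.toReal_nonneg,
          ENNReal.ofReal_toReal htop]
        rfl

theorem abs_sub_le_volume_real {I : Set ℝ} (hI : I.OrdConnected) (hb : Bornology.IsBounded I)
    {x y : ℝ} (hx : x ∈ I) (hy : y ∈ I) : |x - y| ≤ volume.real I := by
  have hsub : Set.uIcc y x ⊆ I := hI.uIcc_subset hy hx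
  have := measureReal_mono (μ := volume) hsub hb.measure_lt_top.ne
  rwa [Real.volume_real_interval] at this

theorem ResolventBound.carlesonCondition (h : IsRieszCoord φ c C₁ C₂)
    (hA : IsEigenfamily A φ l) (hl : ∀ k, (l k).re < 0)
    (hβ : β ∈ resolventSet A) (hb : HasSum (fun k => b k • embed A β (φ k)) (B 1)) {R : ℝ≥0}
    (hR : ∀ r : ℝ≥0, 0 < r → ν (Set.Iio (2 * r)) ≤ R * ν (Set.Iio r)) {n : ℕ}
    (hn : 2 * R ≤ 2 ^ (2 * n + 1)) (hres : ResolventBound A β B ν (n + 1)) :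
    CarlesonCondition (spectralMeasure b l) ν := by
  obtain ⟨κ, hκ, hres⟩ := hres
  have hC := h.pos_lower
  -- After the powers of `a` and `2` cancel, a single factor `a` remains; it is the length of `I` in
  -- the measure of the square.
  set D : ℝ := 3 ^ (2 * n + 2) / C₁ * (2 * Real.pi * (2 * n).factorial * 2) with hD
  have hD0 : 0 < D := by positivity
  refine ⟨D.toNNReal * κ, mul_pos (Real.toNNReal_pos.2 hD0) hκ, fun I hI hIb => ?_⟩
  set a := volume.real I with ha
  -- Over an interval of length zero the square is empty, since its points would satisfy `0 ≤ Re z <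
  -- 0`.
  rcases (measureReal_nonneg : 0 ≤ volume.real I).eq_or_lt with h0 | h0
  · have : carlesonSquare I = ∅ := by
      ext z
      simp only [carlesonSquare, ← h0, Set.mem_ofPred_eq, Set.mem_empty_iff_false, iff_false]
      intro hz
      linarith [hz.1, hz.2.1]
    simp [this]
  change 0 < a at h0
  obtain ⟨y₀, hy₀⟩ : I.Nonempty := by
    rw [Set.nonempty_iff_ne_empty]
    rintro rfl
    simp [ha] at h0
  have hvol : volume I = ENNReal.ofReal a := (ENNReal.ofReal_toReal hIb.measure_lt_top.ne).symm
  -- The sign is that of `l k`, not of `-l k`, so that the imaginary parts nearly cancel in `z - l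
  -- k`.
  set z : ℂ := a - y₀ * Complex.I with hz
  have hzre : z.re = a := by simp [hz]
  have hzpos : 0 < z.re := hzre ▸ h0
  have hzρ := mem_resolventSet_of_re_pos h hA hβ hl hzpos
  set y := extendToH A β (resolvent A z ^ (n + 1)) (B 1) with hy
  have hcy : ∀ k, c k y = ((z - l k) ^ (n + 1))⁻¹ * b k := fun k => by
    rw [hy, coord_extendToH_resolvent_pow h hA hβ hzρ, ← extCoord_apply,
      extCoord_hasSum h hA hβ hb]
  have hne := sub_ne_zero_of_mem_resolventSet h hA hzρ
  have hpt : ∀ k, -l k ∈ carlesonSquare I → ‖b k‖ ^ 2 ≤ (3 * a) ^ (2 * n + 2) * ‖c k y‖ ^ 2 := by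
    intro k hk
    have hn3 : ‖z - l k‖ ≤ 3 * a := by
      refine (Complex.norm_le_abs_re_add_abs_im _).trans ?_
      have h1 : (z - l k).re = a + (-l k).re := by simp [hz]; ring
      have h2 : (z - l k).im = (-l k).im - y₀ := by simp [hz]; ring
      have h3 := abs_sub_le_volume_real hI hIb hk.2.2 hy₀
      have h4 := hk.1
      have h5 := hk.2.1
      rw [h1, h2, abs_of_nonneg (by positivity)]
      linarith
    have e : b k = (z - l k) ^ (n + 1) * c k y := by
      rw [hcy, mul_inv_cancel_left₀ (pow_ne_zero _ (hne k))]
    rw [e, norm_mul, mul_pow, norm_pow, ← pow_mul, show (n + 1) * 2 = 2 * n + 2 by ring]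
    gcongr
  have hker := lintegral_kernel_sq_mul_weight ν n hzpos
  rw [hzre] at hker
  calc spectralMeasure b l (carlesonSquare I)
      ≤ ∑' k, ENNReal.ofReal ((3 * a) ^ (2 * n + 2)) * ENNReal.ofReal (‖c k y‖ ^ 2) := by
        rw [spectralMeasure_apply b l (measurableSet_carlesonSquare hI)]
        refine ENNReal.tsum_le_tsum fun k => ?_
        by_cases hk : -l k ∈ carlesonSquare I
        · rw [Set.indicator_of_mem hk, ← ENNReal.ofReal_mul (by positivity)]
          simpa using ENNReal.ofReal_le_ofReal (hpt k hk)
        · simp [Set.indicator_of_notMem hk]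
    _ = ENNReal.ofReal ((3 * a) ^ (2 * n + 2)) * ENNReal.ofReal (∑' k, ‖c k y‖ ^ 2) := by
        rw [ENNReal.tsum_mul_left, ENNReal.ofReal_tsum_of_nonneg (fun k => by positivity)
          (h.summable y)]
    _ ≤ ENNReal.ofReal ((3 * a) ^ (2 * n + 2)) * ENNReal.ofReal (‖y‖ ^ 2 / C₁) := by
        gcongr
        rw [le_div_iff₀' hC]
        exact h.lower y
    _ = ENNReal.ofReal ((3 * a) ^ (2 * n + 2) / C₁) * ‖y‖ₑ ^ 2 := by
        rw [← ENNReal.ofReal_mul (by positivity), mul_div_left_comm, mul_comm,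
          ENNReal.ofReal_mul (by positivity), ENNReal.ofReal_pow (norm_nonneg _), ofReal_norm]
    _ ≤ ENNReal.ofReal ((3 * a) ^ (2 * n + 2) / C₁) * (κ * (ENNReal.ofReal (2 * Real.pi) *
          ∫⁻ r : ℝ≥0, ENNReal.ofReal ((2 * n).factorial / (2 * (a + r)) ^ (2 * n + 1)) ∂ν)) := by
        gcongr
        rw [← hker]
        exact hres z hzpos
    _ ≤ ENNReal.ofReal ((3 * a) ^ (2 * n + 2) / C₁) * (κ * (ENNReal.ofReal (2 * Real.pi) *
          (ENNReal.ofReal ((2 * n).factorial / 2 ^ (2 * n + 1)) *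
            (ENNReal.ofReal (2 ^ (2 * n + 1 + 1) / a ^ (2 * n + 1)) *
              ν {r : ℝ≥0 | (r : ℝ) < a})))) := by
        gcongr
        refine le_trans (le_of_eq ?_) (mul_le_mul' le_rfl (lintegral_inv_pow_le hR hn h0))
        rw [← lintegral_const_mul' _ _ ENNReal.ofReal_ne_top]
        refine lintegral_congr fun r => ?_
        rw [← ENNReal.ofReal_mul (by positivity), mul_pow, div_mul_div_comm, mul_one]
    _ = κ * (ENNReal.ofReal ((3 * a) ^ (2 * n + 2) / C₁) * (ENNReal.ofReal (2 * Real.pi) *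
          (ENNReal.ofReal ((2 * n).factorial / 2 ^ (2 * n + 1)) *
            ENNReal.ofReal (2 ^ (2 * n + 1 + 1) / a ^ (2 * n + 1))))) *
              ν {r : ℝ≥0 | (r : ℝ) < a} := by ring
    _ = κ * ENNReal.ofReal (D * a) * ν {r : ℝ≥0 | (r : ℝ) < a} := by
        rw [← ENNReal.ofReal_mul (by positivity), ← ENNReal.ofReal_mul (by positivity),
          ← ENNReal.ofReal_mul (by positivity)]
        congr 3
        rw [hD, mul_pow, pow_succ (2 : ℝ) (2 * n + 1), pow_succ a (2 * n + 1)]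
        field_simp
    _ = _ := by
        rw [planeMeasure_carlesonSquare ν hI, ← ha, hvol, ENNReal.ofReal_mul hD0.le]
        push_cast
        rw [ENNReal.ofReal]
        ring

theorem tendsto_setLIntegral_Ioi_zero {g : ℝ → ℝ≥0∞}
    (hg : ∫⁻ t in Set.Ioi (0 : ℝ), g t ≠ ∞) :
    Tendsto (fun σ : ℝ => ∫⁻ t in Set.Ioi (max σ 0), g t) atTop (𝓝 0) := by
  have hfin : IsFiniteMeasure ((volume.restrict (Set.Ioi (0 : ℝ))).withDensity g) :=
    isFiniteMeasure_withDensity hg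
  have h := tendsto_measure_iInter_atTop
    (μ := (volume.restrict (Set.Ioi (0 : ℝ))).withDensity g) (s := fun σ : ℝ => Set.Ioi σ)
    (fun σ => measurableSet_Ioi.nullMeasurableSet) (fun σ τ hστ => Set.Ioi_subset_Ioi hστ)
    ⟨0, measure_ne_top _ _⟩
  have hempty : ⋂ σ : ℝ, Set.Ioi σ = ∅ := by
    ext x
    simp only [Set.mem_iInter, Set.mem_Ioi, Set.mem_empty_iff_false, iff_false, not_forall, not_lt]
    exact ⟨x, le_rfl⟩
  rw [hempty, measure_empty] at h
  refine h.congr fun σ => ?_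
  rw [Function.comp_apply, withDensity_apply _ measurableSet_Ioi,
    Measure.restrict_restrict measurableSet_Ioi, Set.Ioi_inter_Ioi]

theorem setIntegral_Ioc_sub {f : ℝ → ℂ} {σ τ : ℝ} (hστ : σ ≤ τ)
    (hf : IntegrableOn f (Set.Ioc 0 τ)) :
    (∫ t in Set.Ioc 0 τ, f t) - ∫ t in Set.Ioc 0 σ, f t = ∫ t in Set.Ioc (max σ 0) τ, f t := by
  rcases le_total σ 0 with hσ | hσ
  · simp [Set.Ioc_eq_empty (not_lt.2 hσ), max_eq_right hσ]
  · rw [max_eq_left hσ, ← Set.Ioc_union_Ioc_eq_Ioc hσ hστ, setIntegral_union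
      (Set.Ioc_disjoint_Ioc_of_le le_rfl) measurableSet_Ioc
      (hf.mono_set (Set.Ioc_subset_Ioc_right hστ)) (hf.mono_set (Set.Ioc_subset_Ioc_left hσ)),
      add_sub_cancel_left]

/-- The difference of the states at times `σ ≤ τ` is the state of the input restricted to `(σ, τ]`,
which the embedding bounds by the tail of `∫ |u|² w`. The limit in `H` is also the limit in
`D(A*)'`. -/
theorem CarlesonCondition.isAdmissible (h : IsRieszCoord φ c C₁ C₂) (hT : IsC0Semigroup T)
    (hG : IsGenerator A T) (hA : IsEigenfamily A φ l) (hl : ∀ k, (l k).re < 0)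
    (hβ : β ∈ resolventSet A) (hb : HasSum (fun k => b k • embed A β (φ k)) (B 1)) {R : ℝ≥0}
    (hR : ∀ r : ℝ≥0, 0 < r → ν (Set.Iio (2 * r)) ≤ R * ν (Set.Iio r)) (h0 : ν ≠ 0)
    (hC : CarlesonCondition (spectralMeasure b l) ν) : IsAdmissible A T β B ν := by
  obtain ⟨K, hK⟩ := hC.sum_le hR hl
  have hC2 := h.pos_upper
  set M : ℝ := C₂ * (192 * K) with hM
  have hM0 : 0 ≤ M := by positivity
  -- The summand `1` only keeps the constant positive when `M = 0`.
  refine ⟨Real.sqrt M + 1, by positivity, fun u hu => ?_⟩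
  have hm := aestronglyMeasurable_of_weightMeasure h0 hu.1
  have hsq := eLpNorm_sq_weightMeasure ν hm
  have hfin : ∫⁻ t in Set.Ioi (0 : ℝ), ‖u t‖ₑ ^ 2 * weight ν t ≠ ∞ := by
    rw [← hsq]
    exact (ENNReal.pow_lt_top hu.2).ne
  have hui : ∀ τ : ℝ, IntegrableOn u (Set.Ioc 0 τ) := fun τ =>
    (memLp_restrict_Ioc h0 hu le_rfl τ).integrable (by norm_num)
  have hker := fun τ => integrableOn_extend hT hG hβ B (hui τ)
  choose x hx hxn using fun τ => exists_state_of_carleson h hl h0 hK hu le_rfl τ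
  have hsqrt : ∀ {y : H} {e : ℝ}, ‖y‖ ^ 2 ≤ M * e → ‖y‖ ≤ Real.sqrt (M * e) :=
    fun hy => Real.le_sqrt_of_sq_le hy
  have hcauchy : CauchySeq x := by
    refine cauchySeq_of_le_tendsto_0' (fun σ : ℝ => Real.sqrt (M *
      (∫⁻ t in Set.Ioi (max σ 0), ‖u t‖ₑ ^ 2 * weight ν t).toReal)) (fun σ τ hστ => ?_) ?_
    · obtain ⟨y, hy, hyn⟩ := exists_state_of_carleson h hl h0 hK hu (le_max_right σ 0) τ
      have e : x τ - x σ = y := h.ext fun k => by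
        rw [map_sub, hx, hx, hy, ← mul_sub, setIntegral_Ioc_sub hστ]
        exact (hui τ).mul_continuousOn_of_subset (K := Set.Icc 0 τ) (by fun_prop)
          measurableSet_Ioc isCompact_Icc Set.Ioc_subset_Icc_self
      rw [dist_comm, dist_eq_norm, e]
      exact hsqrt hyn
    · have := ((ENNReal.tendsto_toReal ENNReal.zero_ne_top).comp
        (tendsto_setLIntegral_Ioi_zero hfin)).const_mul M
      rw [ENNReal.toReal_zero, mul_zero] at this
      have h1 := (Real.continuous_sqrt.tendsto _).comp this
      rwa [Real.sqrt_zero] at h1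
  obtain ⟨x₀, hx₀⟩ := cauchySeq_tendsto_of_complete hcauchy
  refine ⟨x₀, ⟨hker, ?_⟩, ?_⟩
  · have e : ∀ τ : ℝ, ∫ t in Set.Ioc 0 τ, extend A β (T t) (B (u t)) = embed A β (x τ) :=
      fun τ => extCoord_ext h hA hβ fun k => by
        rw [extCoord_integral h hT hG hA hβ hb (hker τ), extCoord_embed h hA hβ, hx]
    simp only [e]
    exact ((continuous_embed A β).tendsto x₀).comp hx₀
  · refine le_of_tendsto hx₀.norm (Eventually.of_forall fun τ => ?_)
    refine (hsqrt (hxn τ)).trans ?_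
    rw [← hsq, ENNReal.toReal_pow, Real.sqrt_mul hM0, Real.sqrt_sq ENNReal.toReal_nonneg]
    refine mul_le_mul_of_nonneg_right ?_ ENNReal.toReal_nonneg
    linarith

end Main

end ZenAdm

end

theorem mainTheorem2 (ν : MeasureTheory.Measure NNReal) (hν : ZenAdm.IsZenMeasure ν) :
    ∃ N₀ : ℕ, 1 ≤ N₀ ∧ ∀ N : ℕ, N₀ ≤ N →
      ∀ (H : Type*) [NormedAddCommGroup H] [InnerProductSpace ℂ H] [CompleteSpace H]
        (ι : Type*) [Countable ι]
        (A : H →ₗ.[ℂ] H) (T : ℝ → H →L[ℂ] H) (φ : ι → H) (l : ι → ℂ) (b : ι → ℂ)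
        (β : ℂ) (B : ℂ →L[ℂ] ZenAdm.Extrapolation A β),
        ZenAdm.IsC0Semigroup T → ZenAdm.IsGenerator A T →
        ZenAdm.IsRieszBasis φ → ZenAdm.IsEigenfamily A φ l → (∀ k, (l k).re < 0) →
        β ∈ ZenAdm.resolventSet A →
        -- `B` is given by the sequence `(b_k)`: `B 1 = ∑ b_k φ_k` in `D(A*)'`
        HasSum (fun k => b k • ZenAdm.embed A β (φ k)) (B 1) →
        List.TFAE
          [ZenAdm.IsAdmissible A T β B ν,
            ZenAdm.ResolventBound A β B ν N,
            ZenAdm.CarlesonCondition (ZenAdm.spectralMeasure b l) ν] := by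
  have hloc := hν.locallyFinite
  obtain ⟨R, hR⟩ := hν.doubling
  have h0 : ν ≠ 0 := by
    rintro rfl
    exact absurd (hν.pos 1 one_pos) (by simp)
  -- With `N = n + 1 ≥ N₁ + 1` the exponent `2n + 1` is at least `N₁`, so the threshold depends only
  -- on the doubling constant.
  obtain ⟨N₁, hN₁⟩ := pow_unbounded_of_one_lt (2 * R) one_lt_two
  refine ⟨N₁ + 1, Nat.le_add_left 1 N₁, fun N hN => ?_⟩
  obtain ⟨n, rfl⟩ : ∃ n, N = n + 1 := ⟨N - 1, by omega⟩
  intro H _ _ _ ι _ A T φ l b β B hT hG hφ hA hl hβ hb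
  obtain ⟨c, C₁, C₂, h⟩ := hφ.exists_coord
  have hn : 2 * R ≤ 2 ^ (2 * n + 1) :=
    hN₁.le.trans (pow_le_pow_right₀ one_le_two (by omega))
  tfae_have 1 → 2 := fun hadm => hadm.resolventBound h hT hG hA hl hβ hb n
  tfae_have 2 → 3 := fun hres => hres.carlesonCondition h hA hl hβ hb hR hn
  tfae_have 3 → 1 := fun hC => hC.isAdmissible h hT hG hA hl hβ hb hR h0
  tfae_finish
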